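/- **Theorem.** Let $n\in\mathbb N$ and let $\hbar,\tau,\varsigma>0$. *Notation.* Scalar products are linear in the first argument, $L_2$-spaces are with respect to Lebesgue measure, and $\omega(x,y;x',y')=x\cdot y'-x'\cdot y$. For $(x,y)\in\mathbb R^{2m}$ let $$[\rho(x,y)f](t)=e^{\pi i\hbar(-2y\cdot t+x\cdot y)}f(t-x)\quad(f:\mathbb R^m\to\mathbb C),\qquad [\Lambda_\hbar(x,y)F](x',y')=e^{\pi i\hbar(x\cdot y'-y\cdot x')}F(x'-x,y'-y)\quad(F:\mathbb R^{2m}\to\mathbb C)$$ be the Schrödinger representation and the left pulled action of the Heisenberg group; $\mathcal W(f,\phi)(x,y)=\langle f,\rho(x,y)\phi\rangle$ is the Fourier–Wigner transform and $$F^{\frown}(x,y)=(\hbar/2)^m\int_{\mathbb R^{2m}}F(x',y')\,e^{\pi i\hbar(x'\cdot y-y'\cdot x)}\,dx'\,dy'$$ is the symplectic Fourier transform. Let $\varphi_\tau(t)=(2\hbar/\tau)^{n/4}e^{-\pi\hbar|t|^2/\tau}$ on $\mathbb R^n$, let $\mathcal F_\tau=\{\mathcal W(h,\varphi_\tau):h\in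 L_2(\mathbb R^n)\}$ (a closed subspace of $L_2(\mathbb R^{2n})$, the pre-Fock–Segal–Bargmann space), let $P_\tau$ be the orthogonal projection of $L_2(\mathbb R^{2n})$ onto $\mathcal F_\tau$, and let $\Phi_{\tau\varsigma}=\mathcal W(\varphi_\varsigma,\varphi_\tau)$ be the mixed Gaussian. The Weyl pseudo-differential operator (PDO) $a(D,X)$ on $\mathbb R^m$ with symbol $a:\mathbb R^{2m}\to\mathbb C$ is the integrated representation $\int_{\mathbb R^{2m}} a^{\frown}(x,y)\,\rho(x,y)\,dx\,dy$ in the weak sense: for Schwartz functions $f,g$ on $\mathbb R^m$, $$\langle a(D,X)f,g\rangle=\int_{\mathbb R^{2m}}a(p)\,\overline{\mathcal W(g,f)^{\frown}(p)}\,dp .$$ We say that a (possibly unbounded) operator $A$ in $L_2(\mathbb R^m)$ *is* the PDO with symbol $a$ if these integrals converge absolutely for all Schwartz $f,g$, the domains of $A$ and of its adjoint contain all Schwartz functions, and $\langle Af,g\rangle=\langle a(D,X)f,g\rangle$ for all Schwartz $f,g$. (Then $a$ determines the values of $A$ on its whole domain.) For a function $\psi$ on $\mathbb R^{2n}$ such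 that $(1+|z|)^{-N}\psi(z)$ is in $L_2(\mathbb R^{2n})$ for some $N\in\mathbb N$ (for example, a bounded measurable function, or a measurable function of polynomial growth), the cross-Toeplitz operator $T_\psi:\mathcal F_\tau\to\mathcal F_\varsigma$ is $T_\psi f=P_\varsigma(\psi f)$, with domain $\{f\in\mathcal F_\tau:\psi f\in L_2(\mathbb R^{2n})\}$. *Statement.* There are a unitary operator $V:L_2(\mathbb R^{2n})\to L_2(\mathbb R^{2n})$ and the unitary operator $U:\mathcal F_\varsigma\to\mathcal F_\tau$, $U\,\mathcal W(h,\varphi_\varsigma)=\mathcal W(h,\varphi_\tau)$ for $h\in L_2(\mathbb R^n)$, such that for every $\psi$ as above the following holds. 1. For all $x_1,x_2,y_1,y_2\in\mathbb R^n$ the first integral below converges absolutely, and $$a^{\#}_\psi(x_1,x_2,y_1,y_2):=\int_{\mathbb R^{2n}}\psi(x,y)\,[\Lambda_\hbar(2x-x_1,2y-y_1)\Phi_{\tau\varsigma}](\varsigma y_2,x_2/\varsigma)\,dx\,dy =\int_{\mathbb R^{2n}}\psi(x,y)\,\overline{[\Lambda_\hbar(\varsigma y_2,x_2/\varsigma)\Phi_{\varsigma\tau}](2x-x_1,2y-y_1)}\,dx\,dy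 .$$ 2. There is an operator $A$ in $L_2(\mathbb R^{2n})$ which is the Weyl PDO on $\mathbb R^{2n}$ with symbol $\hbar^{3n}a^{\#}_\psi$, as a function of $((x_1,x_2),(y_1,y_2))\in\mathbb R^{2n}\times\mathbb R^{2n}$, such that $T_\psi$ is unitarily equivalent to the restriction of $A$ to $V\mathcal F_\tau$, which maps into $V\mathcal F_\tau$: for $f\in\mathcal F_\tau$, $Vf$ is in the domain of $A$ if and only if $f$ is in the domain of $T_\psi$, and then $$A\,Vf=V\,U\,T_\psi f .$$ More generally, for $f\in L_2(\mathbb R^{2n})$, $Vf$ is in the domain of $A$ if and only if $\psi f\in L_2(\mathbb R^{2n})$, and then $A\,Vf=V\,U\,P_\varsigma(\psi f)$. -/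

import Mathlib

open MeasureTheory Complex
open scoped ComplexConjugate SchwartzMap

noncomputable section

/-- The configuration space `ℝᵐ`, coordinates indexed by `ι`, with its Euclidean structure. -/
abbrev RSpace (ι : Type*) := EuclideanSpace ℝ ι

/-- The phase space `ℝ²ᵐ`; points are pairs `(x, y)`. -/
abbrev Phase (ι : Type*) := RSpace ι × RSpace ι

/-- `L²` of the configuration space, with Lebesgue measure. -/
abbrev L2R (ι : Type*) [Fintype ι] := Lp ℂ 2 (volume : Measure (RSpace ι))

/-- `L²` of the phase space, with Lebesgue measure `dx dy`. -/
abbrev L2P (ι : Type*) [Fintype ι] := Lp ℂ 2 (volume : Measure (Phase ι))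

variable {ι : Type*} [Fintype ι]

/-- The symplectic form `ω(x, y; x', y') = x y' - x' y`. -/
def symplForm (z w : Phase ι) : ℝ := inner ℝ z.1 w.2 - inner ℝ w.1 z.2

/-- The Schrödinger representation
`[ρ(0, x, y) f](t) = exp (π i ħ (-2 y t + x y)) f (t - x)`, with `z = (x, y)`. -/
def schrodingerRep (ħ : ℝ) (z : Phase ι) (f : RSpace ι → ℂ) : RSpace ι → ℂ := fun t =>
  cexp (Real.pi * I * ħ * ((-2 * inner ℝ z.2 t + inner ℝ z.1 z.2 : ℝ) : ℂ)) * f (t - z.1)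

/-- The left pulled action
`[Λ(0, x, y) F](x', y') = exp (π i ħ (x y' - y x')) F (x' - x, y' - y)`. -/
def leftAction (ħ : ℝ) (z : Phase ι) (F : Phase ι → ℂ) : Phase ι → ℂ := fun w =>
  cexp (Real.pi * I * ħ * (symplForm z w : ℂ)) * F (w - z)

/-- The Fourier–Wigner (covariant) transform `W(f, φ)(x, y) = ⟨f, ρ(0, x, y) φ⟩`
(the scalar product is linear in the first argument). -/
def fourierWigner (ħ : ℝ) (f φ : RSpace ι → ℂ) : Phase ι → ℂ := fun z =>
  ∫ t, f t * conj (schrodingerRep ħ z φ t)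

/-- The symplectic Fourier transform
`(ħ/2)ᵐ ∫ F(x', y') exp (π i ħ (x' y - y' x)) dx' dy'`. -/
def symplFourier (ħ : ℝ) (F : Phase ι → ℂ) : Phase ι → ℂ := fun z =>
  ((ħ / 2 : ℝ) : ℂ) ^ Fintype.card ι *
    ∫ w, F w * cexp (Real.pi * I * ħ * (symplForm w z : ℂ))

/-- The squeezed Gaussian `φ_τ(t) = (2ħ/τ)^(m/4) exp (-π ħ t² / τ)`, of unit norm in `L²(ℝᵐ)`. -/
def squeezedGaussian (ħ τ : ℝ) : RSpace ι → ℂ := fun t =>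
  (((2 * ħ / τ) ^ ((Fintype.card ι : ℝ) / 4) * Real.exp (-Real.pi * ħ * ‖t‖ ^ 2 / τ) : ℝ) : ℂ)

/-- The mixed Gaussian `Φ_{τς}(x, y) = ⟨φ_ς, ρ(0, x, y) φ_τ⟩`. -/
def mixedGaussian (ħ τ ς : ℝ) : Phase ι → ℂ :=
  fourierWigner ħ (squeezedGaussian ħ ς) (squeezedGaussian ħ τ)

/-- The (pre-)Fock–Segal–Bargmann space `F_τ ⊆ L²(ℝ²ᵐ)`: all transforms `W(h, φ_τ)`,
`h ∈ L²(ℝᵐ)`. The map `h ↦ W(h, φ_τ)` is linear and a multiple of an isometry, so these functions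
already form a closed subspace; the span and the closure add nothing, they only make the
orthogonal projection available. -/
def preFSB (ι : Type*) [Fintype ι] (ħ τ : ℝ) : Submodule ℂ (L2P ι) :=
  (Submodule.span ℂ {F : L2P ι | ∃ h : L2R ι,
    ⇑F =ᵐ[volume] fourierWigner ħ h (squeezedGaussian ħ τ)}).topologicalClosure

instance (ħ τ : ℝ) : CompleteSpace (preFSB ι ħ τ) :=
  (Submodule.isClosed_topologicalClosure _).completeSpace_coe

/-- All `f ∈ L²(ℝ²ᵐ)` such that `ψ f ∈ L²(ℝ²ᵐ)`. -/
def mulDomain (ψ : Phase ι → ℂ) : Submodule ℂ (L2P ι) where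
  carrier := {f | MemLp (fun z => ψ z * f z) 2 volume}
  zero_mem' := by
    refine (memLp_congr_ae ?_).2 (MemLp.zero' (p := 2) (μ := (volume : Measure (Phase ι))))
    filter_upwards [Lp.coeFn_zero ℂ 2 (volume : Measure (Phase ι))] with z hz
    rw [hz]
    simp
  add_mem' := by
    intro f g hf hg
    refine (memLp_congr_ae ?_).2 (MemLp.add hf hg)
    filter_upwards [Lp.coeFn_add f g] with z hz
    rw [hz]
    simp [mul_add]
  smul_mem' := by
    intro c f hf
    refine (memLp_congr_ae ?_).2 (MemLp.const_smul hf c)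
    filter_upwards [Lp.coeFn_smul c f] with z hz
    rw [hz]
    simp only [Pi.smul_apply, smul_eq_mul]
    ring

theorem mem_mulDomain {ψ : Phase ι → ℂ} {f : L2P ι} :
    f ∈ mulDomain ψ ↔ MemLp (fun z => ψ z * f z) 2 volume := Iff.rfl

/-- The multiplication operator `f ↦ ψ f` on its natural domain. -/
def mulOp (ψ : Phase ι → ℂ) : mulDomain ψ →ₗ[ℂ] L2P ι where
  toFun f := MemLp.toLp (fun z => ψ z * (f : L2P ι) z) (mem_mulDomain.1 f.2)
  map_add' f g := by
    rw [← MemLp.toLp_add]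
    refine MemLp.toLp_congr _ _ ?_
    filter_upwards [Lp.coeFn_add (f : L2P ι) (g : L2P ι)] with z hz
    rw [Submodule.coe_add, hz]
    simp [mul_add]
  map_smul' c f := by
    rw [RingHom.id_apply, ← MemLp.toLp_const_smul]
    refine MemLp.toLp_congr _ _ ?_
    filter_upwards [Lp.coeFn_smul c (f : L2P ι)] with z hz
    rw [Submodule.coe_smul, hz]
    simp only [Pi.smul_apply, smul_eq_mul]
    ring

/-- The operator `f ↦ P_ς (ψ f)` from `L²(ℝ²ᵐ)` to `F_ς`, where `P_ς` is the orthogonal projection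
on `F_ς`, with its natural domain: all `f` with `ψ f ∈ L²`. -/
def projMul (ħ ς : ℝ) (ψ : Phase ι → ℂ) : L2P ι →ₗ.[ℂ] preFSB ι ħ ς where
  domain := mulDomain ψ
  toFun := (preFSB ι ħ ς).orthogonalProjectionOnto.toLinearMap ∘ₗ mulOp ψ

/-- The cross-Toeplitz operator `T_ψ : F_τ → F_ς`, `T_ψ f = P_ς (ψ f)`, with its natural domain:
all `f ∈ F_τ` such that `ψ f ∈ L²`. -/
def crossToeplitz (ħ τ ς : ℝ) (ψ : Phase ι → ℂ) : preFSB ι ħ τ →ₗ.[ℂ] preFSB ι ħ ς where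
  domain := (mulDomain ψ).comap (preFSB ι ħ τ).subtype
  toFun := (preFSB ι ħ ς).orthogonalProjectionOnto.toLinearMap ∘ₗ mulOp ψ ∘ₗ
    (preFSB ι ħ τ).subtype.submoduleComap (mulDomain ψ)

/-- The component `x₁` of `(x₁, x₂) ∈ ℝ²ᵐ`. -/
def part₁ (X : RSpace (ι ⊕ ι)) : RSpace ι := WithLp.toLp 2 fun i => X (Sum.inl i)

/-- The component `x₂` of `(x₁, x₂) ∈ ℝ²ᵐ`. -/
def part₂ (X : RSpace (ι ⊕ ι)) : RSpace ι := WithLp.toLp 2 fun i => X (Sum.inr i)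

/-- The integrand
`ψ(x, y) [Λ(2x - x₁, 2y - y₁) Φ_{τς}](ς y₂, x₂ / ς)` at `z = (x, y)`;
here `p = ((x₁, x₂), (y₁, y₂))`. -/
def crossIntegrand (ħ τ ς : ℝ) (ψ : Phase ι → ℂ) (p : Phase (ι ⊕ ι)) : Phase ι → ℂ := fun z =>
  ψ z * leftAction ħ ((2 : ℝ) • z - (part₁ p.1, part₁ p.2)) (mixedGaussian ħ τ ς)
    (ς • part₂ p.2, ς⁻¹ • part₂ p.1)

/-- The function `a^#_ψ(x₁, x₂, y₁, y₂)
= ∫ ψ(x, y) [Λ(2x - x₁, 2y - y₁) Φ_{τς}](ς y₂, x₂ / ς) dx dy`. -/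
def crossSymbol (ħ τ ς : ℝ) (ψ : Phase ι → ℂ) : Phase (ι ⊕ ι) → ℂ := fun p =>
  ∫ z, crossIntegrand ħ τ ς ψ p z

/-- The integrand of the Weyl pairing:
`a` times the complex conjugate of the symplectic Fourier transform of `W(g, f)`. -/
def weylIntegrand (ħ : ℝ) (a : Phase ι → ℂ) (f g : 𝓢(RSpace ι, ℂ)) : Phase ι → ℂ := fun p =>
  a p * conj (symplFourier ħ (fourierWigner ħ g f) p)

/-- The number `⟨a(D,X) f, g⟩` for Schwartz `f`, `g`, where
`a(D,X) = ∫ â(x, y) ρ(0, x, y) dx dy` is understood in the weak sense, `â` being the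
symplectic Fourier transform of the Weyl symbol `a`: the pairing
`∫ â(x, y) ⟨ρ(0, x, y) f, g⟩ dx dy` of `â` with `W(g, f)` is written, the symplectic Fourier
transform being unitary, as the pairing of `a` with the transform of `W(g, f)`. -/
def weylForm (ħ : ℝ) (a : Phase ι → ℂ) (f g : 𝓢(RSpace ι, ℂ)) : ℂ :=
  ∫ p, weylIntegrand ħ a f g p

/-- `A` is an operator in `L²(ℝᵐ)` (possibly unbounded, with domain `A.domain`) which is the
pseudo-differential operator `a(D,X)` with Weyl symbol `a`: its domain and the domain of its adjoint
contain all Schwartz functions, and `⟨A f, g⟩ = ⟨a(D,X) f, g⟩` for Schwartz `f`, `g`.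
By the condition on the adjoint, `a` determines the values of `A` on all of its domain.
(Mathlib's `inner ℂ g f` is the scalar product `⟨f, g⟩` linear in `f`.) -/
def IsWeylPDO (ħ : ℝ) (a : Phase ι → ℂ) (A : L2R ι →ₗ.[ℂ] L2R ι) : Prop :=
  (∀ f g : 𝓢(RSpace ι, ℂ), Integrable (weylIntegrand ħ a f g)) ∧
  (∀ f : 𝓢(RSpace ι, ℂ), ∃ hf : f.toLp 2 volume ∈ A.domain, ∀ g : 𝓢(RSpace ι, ℂ),
    inner ℂ (g.toLp 2 volume) (A ⟨f.toLp 2 volume, hf⟩) = weylForm ħ a f g) ∧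
  (∀ g : 𝓢(RSpace ι, ℂ), ∃ k : L2R ι, ∀ u : A.domain,
    inner ℂ (g.toLp 2 volume) (A u) = inner ℂ k (u : L2R ι))

end

noncomputable section

open scoped FourierTransform

/-! Put `J_τ h = ħ^(n/2) W(h, φ_τ)`. By the Moyal identity (`lintegral_fourierWigner_sq`) this is an
isometry of `L²(ℝⁿ)` onto `F_τ`. Hence `U = J_τ J_ς⁻¹`, and the adjoint of `U P_ς` is `J_ς J_τ*`.
Covariance of `W` makes it an integral operator: `(J_ς J_τ* G)(z) = ħⁿ ∫ G(w) conj([Λ(z)Φ_τς](w))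
dw` (`coeFn_windowChangeAdjoint`).

Take `A = V U P_ς ψ V⁻¹` on its natural domain. The statements on domains and intertwining then hold
by construction for any unitary `V`. What depends on `V` is the Weyl symbol: for Schwartz `f`, `g`
the number `⟨A f, g⟩ = ∫ ψ(z) (V⁻¹f)(z) conj((J_ς J_τ* V⁻¹g)(z)) dz` has to be the Weyl form of
`ħ^(3n) a^#_ψ`.

The symplectic Fourier transform of `W(g, f)` is `W(g, f(-·))` (`symplFourier_fourierWigner`), and
the symbol is a superposition `∫ ψ(z) K_z(p) dz`. By Fubini it suffices to pair each `K_z` with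
`conj W(g, f(-·))` and to find a rank one form (`integral_symbolKernel_mul_conj_fourierWigner`). The
reflected window produces `conj(g(t)) f(X - t)`. Integrating out `Y` leaves a product of a function
of `t` and a function of `s = X - t`, and the integral of this convolution over `X` factorises. The
factor in `s` is the integral of `f(s) exp(2πiħ(y·s₁ + x·s₂/ς - s₁·s₂/ς))`. This dictates `V⁻¹`:
multiplication by a chirp, the inverse Fourier transform, a linear change of variables and a phase,
all unitary. The factor in `t` is, up to constants, the kernel of `J_ς J_τ*` applied to `V⁻¹g`. Only
the continuity and rapid decay of `Φ` enter this computation; the Gaussian integral is never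
evaluated.

The analytic input is that `W` of two functions of class `RapidFourier` (Schwartz functions,
Gaussians) decays rapidly. This absorbs the moderate growth of `ψ` in the symbol integral, in
Fubini's theorem, and in the conditions on the domains of `A` and its adjoint. -/

theorem part₁_add {ι : Type*} (s t : RSpace (ι ⊕ ι)) :
    part₁ (s + t) = part₁ s + part₁ t := rfl

theorem part₂_add {ι : Type*} (s t : RSpace (ι ⊕ ι)) :
    part₂ (s + t) = part₂ s + part₂ t := rfl

/-! ### Rapidly decaying functions -/

section

variable {ι : Type*} [Fintype ι]

/-- The function `f` decays faster than every power of the norm. -/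
def RapidDecay {E F : Type*} [NormedAddCommGroup E] [NormedAddCommGroup F] (f : E → F) : Prop :=
  ∀ N : ℕ, ∃ C : ℝ, ∀ x, ‖f x‖ * (1 + ‖x‖) ^ N ≤ C

section RapidDecay

variable {E E' F G : Type*} [NormedAddCommGroup E] [NormedAddCommGroup E'] [NormedAddCommGroup F]
  [NormedAddCommGroup G]

/-- Peetre's inequality: it moves polynomial weights through translations and convolutions. -/
theorem one_add_norm_pow_le_mul (x y : E) (N : ℕ) :
    (1 + ‖x‖) ^ N ≤ (1 + ‖y‖) ^ N * (1 + ‖y - x‖) ^ N := by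
  rw [← mul_pow]
  gcongr
  have h : ‖x‖ ≤ ‖y‖ + ‖y - x‖ := by
    have := norm_sub_le y (y - x)
    simpa using this
  nlinarith [norm_nonneg y, norm_nonneg (y - x)]

theorem RapidDecay.of_le {f : E → F} {g : E → G} (hf : RapidDecay f) (K : ℝ) (hK : 0 ≤ K) (M : ℕ)
    (h : ∀ x, ‖g x‖ ≤ K * (1 + ‖x‖) ^ M * ‖f x‖) : RapidDecay g := by
  intro N
  obtain ⟨C, hC⟩ := hf (M + N)
  refine ⟨K * C, fun x => ?_⟩
  calc ‖g x‖ * (1 + ‖x‖) ^ N ≤ K * (1 + ‖x‖) ^ M * ‖f x‖ * (1 + ‖x‖) ^ N := by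
        gcongr; exact h x
    _ = K * (‖f x‖ * (1 + ‖x‖) ^ (M + N)) := by ring
    _ ≤ K * C := by gcongr; exact hC x

theorem RapidDecay.of_norm_le {f : E → F} {g : E → G} (hf : RapidDecay f)
    (h : ∀ x, ‖g x‖ ≤ ‖f x‖) : RapidDecay g :=
  hf.of_le 1 zero_le_one 0 (by simpa using h)

theorem RapidDecay.bounded {f : E → F} (hf : RapidDecay f) : ∃ C : ℝ, ∀ x, ‖f x‖ ≤ C := by
  obtain ⟨C, hC⟩ := hf 0
  exact ⟨C, by simpa using hC⟩

theorem RapidDecay.comp {f : E → F} (hf : RapidDecay f) (L : E' → E) (K : ℝ) (hK : 0 ≤ K)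
    (hL : ∀ x, ‖x‖ ≤ K * ‖L x‖) : RapidDecay (fun x => f (L x)) := by
  intro N
  obtain ⟨C, hC⟩ := hf N
  refine ⟨(1 + K) ^ N * C, fun x => ?_⟩
  calc ‖f (L x)‖ * (1 + ‖x‖) ^ N ≤ ‖f (L x)‖ * ((1 + K) * (1 + ‖L x‖)) ^ N := by
        gcongr
        nlinarith [hL x, norm_nonneg (L x)]
    _ = (1 + K) ^ N * (‖f (L x)‖ * (1 + ‖L x‖) ^ N) := by rw [mul_pow]; ring
    _ ≤ _ := by gcongr; exact hC _

theorem RapidDecay.comp_neg {f : E → F} (hf : RapidDecay f) : RapidDecay (fun x => f (-x)) :=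
  hf.comp _ 1 zero_le_one (by simp)

theorem RapidDecay.comp_linearEquiv [NormedSpace ℝ E] [NormedSpace ℝ E'] {f : E → F}
    (hf : RapidDecay f) (L : E' ≃L[ℝ] E) : RapidDecay (fun x => f (L x)) :=
  hf.comp _ ‖(L.symm : E →L[ℝ] E')‖ (norm_nonneg _) fun x => by
    simpa using (L.symm : E →L[ℝ] E').le_opNorm (L x)

variable [NormedSpace ℝ E] [FiniteDimensional ℝ E] [MeasurableSpace E] [BorelSpace E]
  {μ : Measure E} [μ.IsAddHaarMeasure]

theorem RapidDecay.integrable {f : E → F} (hf : RapidDecay f) (hm : AEStronglyMeasurable f μ) :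
    Integrable f μ := by
  -- One power above the dimension makes the weight integrable.
  obtain ⟨C, hC⟩ := hf (Module.finrank ℝ E + 1)
  have h1 : Integrable (fun x : E => (1 + ‖x‖) ^ (-((Module.finrank ℝ E + 1 : ℕ) : ℝ))) μ :=
    integrable_one_add_norm (by push_cast; linarith)
  refine (h1.const_mul C).mono' hm (Filter.Eventually.of_forall fun x => ?_)
  have hpos : (0 : ℝ) < 1 + ‖x‖ := by positivity
  rw [Real.rpow_neg hpos.le, Real.rpow_natCast, ← div_eq_mul_inv, le_div_iff₀ (by positivity)]
  exact hC x

theorem RapidDecay.memLp_two {f : E → F} (hf : RapidDecay f) (hm : AEStronglyMeasurable f μ) :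
    MemLp f 2 μ := by
  rw [memLp_two_iff_integrable_sq_norm hm]
  obtain ⟨C, hC⟩ := hf.bounded
  have : RapidDecay (fun x => ‖f x‖ ^ 2) := hf.of_le (|C|) (abs_nonneg _) 0 fun x => by
    simp only [norm_pow, norm_norm, pow_zero, mul_one]
    rw [sq]
    exact mul_le_mul_of_nonneg_right ((hC x).trans (le_abs_self C)) (norm_nonneg _)
  exact this.integrable (by fun_prop)

/-- Peetre's inequality splits the weight in `x` between the two factors. The integral of norms is
kept, since it dominates Fourier–Wigner transforms and the reproducing integral alike, whatever
their phases. -/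
theorem RapidDecay.convolution_le {f : E → F} {g : E → G} (hf : RapidDecay f) (hg : RapidDecay g)
    (hm : AEStronglyMeasurable f μ) (N : ℕ) :
    ∃ C : ℝ, ∀ x, (∫ t, ‖f t‖ * ‖g (t - x)‖ ∂μ) * (1 + ‖x‖) ^ N ≤ C := by
  obtain ⟨C, hC⟩ := hg N
  have h1 : RapidDecay (fun t => ‖f t‖ * (1 + ‖t‖) ^ N) := hf.of_le 1 zero_le_one N fun t => by
    rw [norm_mul, norm_norm, Real.norm_of_nonneg (by positivity)]
    linarith
  have h2 : Integrable (fun t => ‖f t‖ * (1 + ‖t‖) ^ N) μ := h1.integrable (by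
    exact hm.norm.mul (by fun_prop))
  refine ⟨(∫ t, ‖f t‖ * (1 + ‖t‖) ^ N ∂μ) * C, fun x => ?_⟩
  rw [← integral_mul_const, ← integral_mul_const]
  refine integral_mono_of_nonneg (Filter.Eventually.of_forall fun t => by positivity)
    (h2.mul_const C) (Filter.Eventually.of_forall fun t => ?_)
  calc ‖f t‖ * ‖g (t - x)‖ * (1 + ‖x‖) ^ N
      ≤ ‖f t‖ * ‖g (t - x)‖ * ((1 + ‖t‖) ^ N * (1 + ‖t - x‖) ^ N) := by
        gcongr; exact one_add_norm_pow_le_mul x t N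
    _ = ‖f t‖ * (1 + ‖t‖) ^ N * (‖g (t - x)‖ * (1 + ‖t - x‖) ^ N) := by ring
    _ ≤ _ := mul_le_mul_of_nonneg_left (hC _) (by positivity)

end RapidDecay

/-- The weight that tames `ψ` is transferred to `f`, which stays bounded under it. -/
theorem RapidDecay.memLp_mul {E : Type*} [NormedAddCommGroup E] [MeasurableSpace E] [BorelSpace E]
    {μ : Measure E} {f ψ : E → ℂ} (hf : RapidDecay f)
    (hm : AEStronglyMeasurable f μ)
    {N : ℕ} (hψ : MemLp (fun z => ψ z / (((1 + ‖z‖) ^ N : ℝ) : ℂ)) 2 μ) :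
    MemLp (fun z => ψ z * f z) 2 μ := by
  obtain ⟨C, hC⟩ := hf N
  have hne : ∀ z : E, (((1 + ‖z‖) ^ N : ℝ) : ℂ) ≠ 0 := fun z => by
    norm_cast
    positivity
  have heq : (fun z => ψ z * f z) = fun z => (ψ z / (((1 + ‖z‖) ^ N : ℝ) : ℂ)) *
      ((((1 + ‖z‖) ^ N : ℝ) : ℂ) * f z) := by
    ext z
    rw [← mul_assoc, div_mul_cancel₀ _ (hne z)]
  have hc : Continuous fun z : E => (((1 + ‖z‖) ^ N : ℝ) : ℂ) := by fun_prop
  rw [heq]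
  refine hψ.of_le_mul (c := C) (hψ.1.mul (hc.aestronglyMeasurable.mul hm))
    (Filter.Eventually.of_forall fun z => ?_)
  rw [norm_mul, norm_mul (_ : ℂ) (f z), mul_comm, norm_real, Real.norm_of_nonneg (by positivity)]
  gcongr
  rw [mul_comm]
  exact hC z

theorem SchwartzMap.rapidDecay {E : Type*} [NormedAddCommGroup E] [NormedSpace ℝ E] (f : 𝓢(E, ℂ)) :
    RapidDecay f := by
  intro N
  refine ⟨2 ^ N * ((Finset.Iic (N, 0)).sup fun m => SchwartzMap.seminorm ℝ m.1 m.2) f, fun x => ?_⟩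
  have := SchwartzMap.one_add_le_sup_seminorm_apply (𝕜 := ℝ) (m := (N, 0)) (k := N) (n := 0)
    le_rfl le_rfl f x
  rw [norm_iteratedFDeriv_zero, mul_comm] at this
  exact this

/-- The norm on a product is the maximum, so it is enough to control each component uniformly in the
other. -/
theorem rapidDecay_prod {E F G : Type*} [NormedAddCommGroup E] [NormedAddCommGroup F]
    [NormedAddCommGroup G] {f : E × F → G}
    (h₁ : ∀ N : ℕ, ∃ C : ℝ, ∀ z, ‖f z‖ * (1 + ‖z.1‖) ^ N ≤ C)
    (h₂ : ∀ N : ℕ, ∃ C : ℝ, ∀ z, ‖f z‖ * (1 + ‖z.2‖) ^ N ≤ C) : RapidDecay f := by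
  intro N
  obtain ⟨C₁, hC₁⟩ := h₁ N
  obtain ⟨C₂, hC₂⟩ := h₂ N
  refine ⟨max C₁ C₂, fun z => ?_⟩
  rcases max_cases ‖z.1‖ ‖z.2‖ with h | h
  · rw [Prod.norm_def, h.1]
    exact (hC₁ z).trans (le_max_left _ _)
  · rw [Prod.norm_def, h.1]
    exact (hC₂ z).trans (le_max_right _ _)

/-- A continuous function which, together with its inverse Fourier transform, decays rapidly. -/
structure RapidFourier (f : RSpace ι → ℂ) : Prop where
  continuous : Continuous f
  decay : RapidDecay f
  decay_fourierInv : RapidDecay (𝓕⁻ f)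

theorem SchwartzMap.rapidFourier (f : 𝓢(RSpace ι, ℂ)) : RapidFourier f where
  continuous := f.continuous
  decay := f.rapidDecay
  decay_fourierInv := by
    rw [← SchwartzMap.fourierInv_coe]
    exact (𝓕⁻ f).rapidDecay

theorem RapidFourier.integrable {f : RSpace ι → ℂ} (hf : RapidFourier f) : Integrable f :=
  hf.decay.integrable hf.continuous.aestronglyMeasurable

theorem RapidFourier.memLp {f : RSpace ι → ℂ} (hf : RapidFourier f) : MemLp f 2 :=
  hf.decay.memLp_two hf.continuous.aestronglyMeasurable

theorem continuous_fourierInv {f : RSpace ι → ℂ} (hf : Integrable f) : Continuous (𝓕⁻ f) := by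
  have : 𝓕⁻ f = fun w => 𝓕 f (-w) := by
    ext w
    exact Real.fourierInv_eq_fourier_neg f w
  rw [this]
  have h : Continuous (𝓕 f) := VectorFourier.fourierIntegral_continuous Real.continuous_fourierChar
    (by exact continuous_inner) hf
  exact h.comp continuous_neg

theorem RapidFourier.integrable_fourierInv {f : RSpace ι → ℂ} (hf : RapidFourier f) :
    Integrable (𝓕⁻ f) :=
  hf.decay_fourierInv.integrable (continuous_fourierInv hf.integrable).aestronglyMeasurable

theorem RapidFourier.comp_neg {f : RSpace ι → ℂ} (hf : RapidFourier f) :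
    RapidFourier (fun x => f (-x)) where
  continuous := hf.continuous.comp continuous_neg
  decay := hf.decay.comp_neg
  decay_fourierInv := by
    have := (Real.fourierInv_comp_linearIsometry (LinearIsometryEquiv.neg ℝ) f)
    have h : 𝓕⁻ (fun x => f (-x)) = fun w => 𝓕⁻ f (-w) := by
      ext w
      exact this w
    rw [h]
    exact hf.decay_fourierInv.comp_neg

/-! ### The Fourier–Wigner transform of rapidly decaying functions -/

/-- For fixed `x` the transform is, up to a phase, an inverse Fourier transform in `y`; the
slicewise use of Plancherel and of Fourier inversion rests on this. -/
theorem fourierWigner_eq_fourierInv (ħ : ℝ) (f φ : RSpace ι → ℂ) (z : Phase ι) :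
    fourierWigner ħ f φ z = cexp (-(Real.pi * I * ħ * (inner ℝ z.1 z.2 : ℝ))) *
      𝓕⁻ (fun t => f t * conj (φ (t - z.1))) (ħ • z.2) := by
  rw [Real.fourierInv_eq', fourierWigner, ← integral_const_mul]
  congr 1
  ext t
  rw [schrodingerRep, map_mul, ← Complex.exp_conj, smul_eq_mul]
  have : cexp (conj ((Real.pi : ℂ) * I * ħ * ((-2 * inner ℝ z.2 t + inner ℝ z.1 z.2 : ℝ) : ℂ))) =
      cexp (-(Real.pi * I * ħ * (inner ℝ z.1 z.2 : ℝ))) *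
      cexp (((2 * Real.pi * inner ℝ t (ħ • z.2) : ℝ) : ℂ) * I) := by
    rw [← Complex.exp_add, inner_smul_right, real_inner_comm]
    simp only [map_mul, conj_ofReal, conj_I]
    congr 1
    push_cast
    ring
  rw [this]
  ring

theorem norm_fourierWigner (ħ : ℝ) (f φ : RSpace ι → ℂ) (z : Phase ι) :
    ‖fourierWigner ħ f φ z‖ = ‖𝓕⁻ (fun t => f t * conj (φ (t - z.1))) (ħ • z.2)‖ := by
  rw [fourierWigner_eq_fourierInv, norm_mul, Complex.norm_exp]
  simp

theorem norm_schrodingerRep (ħ : ℝ) (z : Phase ι) (f : RSpace ι → ℂ) (t : RSpace ι) :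
    ‖schrodingerRep ħ z f t‖ = ‖f (t - z.1)‖ := by
  rw [schrodingerRep, norm_mul, Complex.norm_exp]
  simp

theorem norm_fourierWigner_le (ħ : ℝ) (f φ : RSpace ι → ℂ) (z : Phase ι) :
    ‖fourierWigner ħ f φ z‖ ≤ ∫ t, ‖f t‖ * ‖φ (t - z.1)‖ := by
  refine (norm_integral_le_integral_norm _).trans (le_of_eq ?_)
  simp [norm_schrodingerRep]

/-- On the frequency side `W(f, φ)` is again a correlation, now of `𝓕⁻ f` and `𝓕⁻ φ` with shift `ħ
y`. Decay in `y` thus reduces to the same estimate as decay in `x`. -/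
theorem norm_fourierWigner_le_fourierInv (ħ : ℝ) {f φ : RSpace ι → ℂ} (hf : RapidFourier f)
    (hφ : RapidFourier φ) (z : Phase ι) :
    ‖fourierWigner ħ f φ z‖ ≤ ∫ ξ, ‖𝓕⁻ f ξ‖ * ‖𝓕⁻ φ (ξ - ħ • z.2)‖ := by
  have hfint := hf.integrable
  set u : RSpace ι → ℂ := fun t => conj (schrodingerRep ħ z φ t) with hu
  have hmeas : Continuous u := by
    have := hφ.continuous
    simp only [hu, schrodingerRep]
    fun_prop
  have huint : Integrable u := by
    refine ((hφ.integrable.comp_sub_right z.1).norm).mono' hmeas.aestronglyMeasurable ?_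
    exact Filter.Eventually.of_forall fun t => by simp [hu, norm_schrodingerRep]
  have hinv : 𝓕 (𝓕⁻ f) = f := by
    refine hf.continuous.fourier_fourierInv_eq hfint ?_
    have h := hf.integrable_fourierInv.comp_neg
    refine h.congr (Filter.Eventually.of_forall fun w => ?_)
    simp only
    rw [Real.fourierInv_eq_fourier_neg, neg_neg]
  -- The multiplication formula for `𝓕`, with `f = 𝓕 (𝓕⁻ f)`.
  have hflip : ∫ t, f t * u t = ∫ ξ, 𝓕⁻ f ξ * 𝓕 u ξ := by
    have := VectorFourier.integral_fourierIntegral_smul_eq_flip (μ := volume) (ν := volume)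
      (L := innerₗ (RSpace ι)) Real.continuous_fourierChar continuous_inner
      hf.integrable_fourierInv huint
    have h2 : ∀ ξ, VectorFourier.fourierIntegral Real.fourierChar volume (innerₗ (RSpace ι)) (𝓕⁻ f) ξ
        = f ξ := fun ξ => congrFun hinv ξ
    simp only [h2, smul_eq_mul, flip_innerₗ] at this
    exact this
  have hnorm : ∀ ξ, ‖𝓕 u ξ‖ = ‖𝓕⁻ φ (ξ - ħ • z.2)‖ := fun ξ => by
    have h1 : 𝓕 u ξ = cexp (-(Real.pi * I * ħ * (inner ℝ z.1 z.2 : ℝ))) *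
        ∫ t, cexp (((-2 * Real.pi * inner ℝ t (ξ - ħ • z.2) : ℝ) : ℂ) * I) *
          conj (φ (t - z.1)) := by
      rw [Real.fourier_eq', ← integral_const_mul]
      congr 1
      ext t
      simp only [hu, schrodingerRep, map_mul, ← Complex.exp_conj, smul_eq_mul]
      rw [← mul_assoc, ← mul_assoc, ← Complex.exp_add, ← Complex.exp_add, inner_sub_right,
        inner_smul_right, real_inner_comm t z.2]
      simp only [conj_ofReal, conj_I]
      congr 2
      push_cast
      ring
    have h2 : ∫ t, cexp (((-2 * Real.pi * inner ℝ t (ξ - ħ • z.2) : ℝ) : ℂ) * I) *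
          conj (φ (t - z.1)) = cexp (((-2 * Real.pi * inner ℝ z.1 (ξ - ħ • z.2) : ℝ) : ℂ) * I) *
          conj (𝓕⁻ φ (ξ - ħ • z.2)) := by
      rw [← integral_add_right_eq_self _ z.1, Real.fourierInv_eq', ← integral_conj,
        ← integral_const_mul]
      congr 1
      ext t
      simp only [add_sub_cancel_right, smul_eq_mul, map_mul, ← Complex.exp_conj, conj_ofReal,
        conj_I, inner_add_left]
      rw [← mul_assoc, ← Complex.exp_add]
      congr 2
      push_cast
      ring
    rw [h1, h2, norm_mul, norm_mul, Complex.norm_exp, Complex.norm_exp, RCLike.norm_conj]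
    simp
  change ‖∫ t, f t * u t‖ ≤ _
  rw [hflip]
  refine (norm_integral_le_integral_norm _).trans (le_of_eq ?_)
  simp [hnorm]

theorem rapidDecay_fourierWigner {ħ : ℝ} (hħ : 0 < ħ) {f φ : RSpace ι → ℂ} (hf : RapidFourier f)
    (hφ : RapidFourier φ) : RapidDecay (fourierWigner ħ f φ) := by
  refine rapidDecay_prod (fun N => ?_) (fun N => ?_)
  · obtain ⟨C, hC⟩ := hf.decay.convolution_le hφ.decay hf.continuous.aestronglyMeasurable
      (μ := volume) N
    refine ⟨C, fun z => le_trans ?_ (hC z.1)⟩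
    gcongr
    exact norm_fourierWigner_le ħ f φ z
  · obtain ⟨C, hC⟩ := hf.decay_fourierInv.convolution_le hφ.decay_fourierInv
      (continuous_fourierInv hf.integrable).aestronglyMeasurable (μ := volume) N
    refine ⟨(1 + ħ⁻¹) ^ N * C, fun z => ?_⟩
    have h1 : 1 + ‖z.2‖ ≤ (1 + ħ⁻¹) * (1 + ‖ħ • z.2‖) := by
      rw [norm_smul, Real.norm_of_nonneg hħ.le]
      have : ħ⁻¹ * (ħ * ‖z.2‖) = ‖z.2‖ := by field_simp
      have h3 : 0 ≤ ħ * ‖z.2‖ := by positivity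
      have h4 : 0 < ħ⁻¹ := by positivity
      nlinarith
    calc _ ≤ (∫ ξ, ‖𝓕⁻ f ξ‖ * ‖𝓕⁻ φ (ξ - ħ • z.2)‖) * ((1 + ħ⁻¹) * (1 + ‖ħ • z.2‖)) ^ N := by
          gcongr
          exact norm_fourierWigner_le_fourierInv ħ hf hφ z
      _ = (1 + ħ⁻¹) ^ N * ((∫ ξ, ‖𝓕⁻ f ξ‖ * ‖𝓕⁻ φ (ξ - ħ • z.2)‖) * (1 + ‖ħ • z.2‖) ^ N) := by
          rw [mul_pow]; ring
      _ ≤ _ := by gcongr; exact hC _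

theorem continuous_fourierWigner (ħ : ℝ) {f φ : RSpace ι → ℂ} (hf : RapidFourier f)
    (hφ : RapidFourier φ) : Continuous (fourierWigner ħ f φ) := by
  obtain ⟨C, hC⟩ := hφ.decay.bounded
  have h1 := hf.continuous
  have h2 := hφ.continuous
  refine continuous_of_dominated (bound := fun t => ‖f t‖ * C) (fun z => ?_)
    (fun z => Filter.Eventually.of_forall fun t => ?_) (hf.integrable.norm.mul_const C)
    (Filter.Eventually.of_forall fun t => ?_)
  · unfold schrodingerRep
    exact Continuous.aestronglyMeasurable (by fun_prop)
  · rw [norm_mul, RCLike.norm_conj, norm_schrodingerRep]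
    gcongr
    exact hC _
  · unfold schrodingerRep
    fun_prop

instance isAddHaarMeasure_phase : (volume : Measure (Phase ι)).IsAddHaarMeasure :=
  inferInstanceAs ((volume : Measure (RSpace ι)).prod volume).IsAddHaarMeasure

theorem integrable_fourierWigner {ħ : ℝ} (hħ : 0 < ħ) {f φ : RSpace ι → ℂ} (hf : RapidFourier f)
    (hφ : RapidFourier φ) : Integrable (fourierWigner ħ f φ) :=
  (rapidDecay_fourierWigner hħ hf hφ).integrable
    (continuous_fourierWigner ħ hf hφ).aestronglyMeasurable

end

section

variable {ι : Type*} [Fintype ι]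

/-! ### Gaussians -/

theorem rapidDecay_exp_neg_mul_sq {E : Type*} [NormedAddCommGroup E] {b : ℝ} (hb : 0 < b) :
    RapidDecay (fun x : E => Real.exp (-b * ‖x‖ ^ 2)) := by
  intro N
  refine ⟨N.factorial * Real.exp (1 + 1 / (4 * b)), fun x => ?_⟩
  -- The polynomial weight is traded for `N! exp(1 + ‖x‖)`; completing the square then bounds the
  -- total exponent by `1 + 1/(4b)`.
  have h1 := Real.pow_div_factorial_le_exp (x := 1 + ‖x‖) (by positivity) N
  rw [div_le_iff₀ (by positivity)] at h1
  have h2 : -b * ‖x‖ ^ 2 + (1 + ‖x‖) ≤ 1 + 1 / (4 * b) := by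
    have h3 : b * (‖x‖ - 1 / (2 * b)) ^ 2 = b * ‖x‖ ^ 2 - ‖x‖ + 1 / (4 * b) := by
      field_simp
      ring
    have h4 : 0 ≤ b * (‖x‖ - 1 / (2 * b)) ^ 2 := by positivity
    linarith
  rw [Real.norm_of_nonneg (Real.exp_pos _).le]
  calc _ ≤ Real.exp (-b * ‖x‖ ^ 2) * (Real.exp (1 + ‖x‖) * N.factorial) := by gcongr
    _ = N.factorial * Real.exp (-b * ‖x‖ ^ 2 + (1 + ‖x‖)) := by
        rw [Real.exp_add (-b * ‖x‖ ^ 2)]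
        ring
    _ ≤ _ := by gcongr

theorem rapidFourier_gaussian {b : ℝ} (hb : 0 < b) (c : ℝ) :
    RapidFourier (fun t : RSpace ι => ((c * Real.exp (-b * ‖t‖ ^ 2) : ℝ) : ℂ)) where
  continuous := by fun_prop
  decay := (rapidDecay_exp_neg_mul_sq (E := RSpace ι) hb).of_le |c| (abs_nonneg _) 0 fun x => by
    rw [norm_real, norm_mul, Real.norm_eq_abs c, pow_zero, mul_one]
  decay_fourierInv := by
    have hre : 0 < (b : ℂ).re := by simpa using hb
    have hπ : 0 < Real.pi ^ 2 / b := by positivity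
    have h : ∀ w : RSpace ι, 𝓕⁻ (fun t : RSpace ι => ((c * Real.exp (-b * ‖t‖ ^ 2) : ℝ) : ℂ)) w =
        c * ((Real.pi / b) ^ (Module.finrank ℝ (RSpace ι) / 2 : ℂ) *
          cexp (-Real.pi ^ 2 * ‖-w‖ ^ 2 / b)) := fun w => by
      rw [← fourier_gaussian_innerProductSpace hre, Real.fourierInv_eq_fourier_neg,
        Real.fourier_eq, Real.fourier_eq, ← integral_const_mul]
      congr 1
      ext t
      simp only [Circle.smul_def, smul_eq_mul]
      push_cast
      ring
    refine (rapidDecay_exp_neg_mul_sq (E := RSpace ι) hπ).of_le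
      (|c| * ‖(Real.pi / b : ℂ) ^ (Module.finrank ℝ (RSpace ι) / 2 : ℂ)‖) (by positivity) 0
      fun w => ?_
    rw [h, norm_mul, norm_mul, norm_real, Real.norm_eq_abs, pow_zero, mul_one, mul_assoc,
      Real.norm_of_nonneg (Real.exp_pos _).le, norm_neg]
    have : -(Real.pi : ℂ) ^ 2 * (‖w‖ : ℂ) ^ 2 / b = ((-(Real.pi ^ 2 / b) * ‖w‖ ^ 2 : ℝ) : ℂ) := by
      push_cast
      ring
    rw [this, Complex.norm_exp, ofReal_re]

theorem rapidFourier_squeezedGaussian {ħ τ : ℝ} (hħ : 0 < ħ) (hτ : 0 < τ) :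
    RapidFourier (squeezedGaussian (ι := ι) ħ τ) := by
  have h := rapidFourier_gaussian (ι := ι) (b := Real.pi * ħ / τ) (by positivity)
    ((2 * ħ / τ) ^ ((Fintype.card ι : ℝ) / 4))
  have heq : (fun t : RSpace ι => (((2 * ħ / τ) ^ ((Fintype.card ι : ℝ) / 4) *
      Real.exp (-(Real.pi * ħ / τ) * ‖t‖ ^ 2) : ℝ) : ℂ)) = squeezedGaussian ħ τ := by
    ext t
    rw [squeezedGaussian]
    congr 3
    ring
  rwa [heq] at h

theorem lintegral_squeezedGaussian_sq {ħ τ : ℝ} (hħ : 0 < ħ) (hτ : 0 < τ) :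
    ∫⁻ t, ‖squeezedGaussian (ι := ι) ħ τ t‖ₑ ^ 2 = 1 := by
  have hg := rapidFourier_squeezedGaussian (ι := ι) hħ hτ
  have hb : 0 < 2 * (Real.pi * ħ / τ) := by positivity
  have hsq : ∀ t : RSpace ι, ‖squeezedGaussian (ι := ι) ħ τ t‖ ^ 2 =
      (2 * ħ / τ) ^ ((Fintype.card ι : ℝ) / 2) * Real.exp (-(2 * (Real.pi * ħ / τ)) * ‖t‖ ^ 2) := by
    intro t
    rw [squeezedGaussian, norm_real, Real.norm_of_nonneg (by positivity), mul_pow,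
      ← Real.rpow_natCast _ 2, ← Real.rpow_mul (by positivity), ← Real.exp_nat_mul]
    congr 2
    · push_cast; ring
    · push_cast; ring
  have hint := (memLp_two_iff_integrable_sq_norm hg.memLp.1).1 hg.memLp
  have h1 : ∫ t : RSpace ι, ‖squeezedGaussian (ι := ι) ħ τ t‖ ^ 2 = 1 := by
    simp_rw [hsq]
    rw [integral_const_mul, GaussianFourier.integral_rexp_neg_mul_sq_norm hb,
      finrank_euclideanSpace, ← Real.mul_rpow (by positivity) (by positivity)]
    have : 2 * ħ / τ * (Real.pi / (2 * (Real.pi * ħ / τ))) = 1 := by field_simp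
    rw [this, Real.one_rpow]
  have h2 := ofReal_integral_eq_lintegral_ofReal hint (Filter.Eventually.of_forall fun t => by positivity)
  rw [h1, ENNReal.ofReal_one] at h2
  rw [h2]
  congr 1
  ext t
  rw [ENNReal.ofReal_pow (norm_nonneg _), ofReal_norm]

/-! ### Plancherel's theorem for integrable and square integrable functions -/

theorem integral_fourierInv_mul_eq {f g : RSpace ι → ℂ} (hf : Integrable f) (hg : Integrable g) :
    ∫ x, 𝓕⁻ f x * g x = ∫ x, f x * 𝓕⁻ g x := by
  have h := VectorFourier.integral_fourierIntegral_smul_eq_flip (μ := volume) (ν := volume)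
      (L := -innerₗ (RSpace ι)) Real.continuous_fourierChar
      (by exact continuous_inner.neg) hf hg
  have h2 : (-innerₗ (RSpace ι)).flip = -innerₗ (RSpace ι) := by
    ext x y
    simp [real_inner_comm]
  rw [h2] at h
  exact h

/-- The abstract `L²` transform and the integral define the same tempered distribution. Testing
against smooth functions of compact support identifies them almost everywhere. -/
theorem fourierInv_toLp_ae_eq {f : RSpace ι → ℂ} (hf : Integrable f) (hf2 : MemLp f 2) :
    (𝓕⁻ (hf2.toLp f) : L2R ι) =ᵐ[volume] 𝓕⁻ f := by
  refine ae_eq_of_integral_contDiff_smul_eq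
    ((Lp.memLp _).locallyIntegrable (by norm_num))
    (continuous_fourierInv hf).locallyIntegrable fun g hg hgs => ?_
  have hg₁ : HasCompactSupport (Complex.ofRealCLM ∘ g) := hgs.comp_left rfl
  have hg₂ : ContDiff ℝ ((⊤ : ℕ∞) : WithTop ℕ∞) (Complex.ofRealCLM ∘ g) := by fun_prop
  set G : 𝓢(RSpace ι, ℂ) := hg₁.toSchwartzMap hg₂ with hG
  have hGg : ∀ x, G x = (g x : ℂ) := fun x => rfl
  have h := congrArg (fun T : TemperedDistribution (RSpace ι) ℂ => T G)
    (Lp.fourierInv_toTemperedDistribution_eq (hf2.toLp f))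
  simp only [TemperedDistribution.fourierInv_apply, Lp.toTemperedDistribution_apply,
    smul_eq_mul] at h
  simp only [real_smul, ← hGg]
  rw [← h, ← integral_congr_ae (f := fun x => 𝓕⁻ G x * f x)
    (hf2.coeFn_toLp.mono fun x hx => by simp only [hx]), SchwartzMap.fourierInv_coe]
  exact integral_fourierInv_mul_eq G.integrable hf

theorem lintegral_fourierInv_sq {f : RSpace ι → ℂ} (hf : Integrable f) (hf2 : MemLp f 2) :
    ∫⁻ x, ‖𝓕⁻ f x‖ₑ ^ 2 = ∫⁻ x, ‖f x‖ₑ ^ 2 := by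
  have h1 : ‖(𝓕⁻ (hf2.toLp f) : L2R ι)‖ₑ = ‖hf2.toLp f‖ₑ := by
    have := (Lp.fourierTransformₗᵢ (RSpace ι) ℂ).symm.norm_map (hf2.toLp f)
    rw [← ofReal_norm, ← ofReal_norm]
    exact congrArg _ this
  rw [Lp.enorm_def, Lp.enorm_def, eLpNorm_congr_ae (fourierInv_toLp_ae_eq hf hf2),
    eLpNorm_congr_ae hf2.coeFn_toLp,
    eLpNorm_eq_lintegral_rpow_enorm_toReal (by norm_num) (by norm_num),
    eLpNorm_eq_lintegral_rpow_enorm_toReal (by norm_num) (by norm_num)] at h1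
  simp only [ENNReal.toReal_ofNat, ENNReal.rpow_ofNat, one_div] at h1
  exact (ENNReal.rpow_left_injective (by norm_num)) h1

end

section

variable {ι : Type*} [Fintype ι]

/-! ### The Fourier–Wigner transform on `L²` -/

theorem RapidFourier.memLp_schrodingerRep {φ : RSpace ι → ℂ} (hφ : RapidFourier φ) (ħ : ℝ)
    (z : Phase ι) : MemLp (schrodingerRep ħ z φ) 2 := by
  have h : MemLp (fun t => φ (t - z.1)) 2 :=
    hφ.memLp.comp_measurePreserving (measurePreserving_sub_right volume z.1)
  refine h.of_le ?_ (Filter.Eventually.of_forall fun t => (norm_schrodingerRep ħ z φ t).le)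
  have := hφ.continuous
  unfold schrodingerRep
  exact Continuous.aestronglyMeasurable (by fun_prop)

theorem fourierWigner_eq_inner (ħ : ℝ) {φ : RSpace ι → ℂ} (hφ : RapidFourier φ) (h : L2R ι)
    (z : Phase ι) :
    fourierWigner ħ h φ z = inner ℂ ((hφ.memLp_schrodingerRep ħ z).toLp _) h := by
  rw [L2.inner_def, fourierWigner]
  refine integral_congr_ae ((hφ.memLp_schrodingerRep ħ z).coeFn_toLp.mono fun t ht => ?_)
  simp only [ht, RCLike.inner_apply]

theorem fourierWigner_congr_ae (ħ : ℝ) {f g : RSpace ι → ℂ} (h : f =ᵐ[volume] g)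
    (φ : RSpace ι → ℂ) : fourierWigner ħ f φ = fourierWigner ħ g φ := by
  ext z
  exact integral_congr_ae (h.mono fun t ht => by simp only [ht])

theorem stronglyMeasurable_fourierWigner (ħ : ℝ) {f φ : RSpace ι → ℂ}
    (hf : StronglyMeasurable f) (hφ : Continuous φ) : StronglyMeasurable (fourierWigner ħ f φ) := by
  refine StronglyMeasurable.integral_prod_right
    (f := fun (z : Phase ι) (t : RSpace ι) => f t * conj (schrodingerRep ħ z φ t)) ?_
  refine (hf.comp_measurable measurable_snd).mul (Continuous.stronglyMeasurable ?_)
  unfold schrodingerRep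
  fun_prop

theorem lintegral_comp_smul_of_pos {f : RSpace ι → ENNReal} (hf : AEMeasurable f) {r : ℝ}
    (hr : 0 < r) : ∫⁻ y, f (r • y) = ENNReal.ofReal ((r ^ Fintype.card ι)⁻¹) * ∫⁻ y, f y := by
  have h := Measure.map_addHaar_smul (volume : Measure (RSpace ι)) hr.ne'
  have hm : AEMeasurable f (Measure.map (r • ·) (volume : Measure (RSpace ι))) := by
    rw [h]
    exact hf.smul_measure _
  rw [← lintegral_map' hm (by fun_prop), h, lintegral_smul_measure, finrank_euclideanSpace,
    abs_of_pos (by positivity), smul_eq_mul]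

/-- Moyal's identity: Plancherel in `y` on every slice of constant `x`, then Tonelli and translation
invariance in `x`. The factor `ħ^(-m)` is the Jacobian of `y ↦ ħ y`. Lower integrals are used
because membership in `L²` is only a consequence. -/
theorem lintegral_fourierWigner_sq {ħ : ℝ} (hħ : 0 < ħ) {φ : RSpace ι → ℂ} (hφ : RapidFourier φ)
    (h : L2R ι) : ∫⁻ z, ‖fourierWigner ħ h φ z‖ₑ ^ 2 =
      ENNReal.ofReal ((ħ ^ Fintype.card ι)⁻¹) * ((∫⁻ t, ‖h t‖ₑ ^ 2) * ∫⁻ t, ‖φ t‖ₑ ^ 2) := by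
  have hhm := Lp.stronglyMeasurable h
  have hφc := hφ.continuous
  have hm := stronglyMeasurable_fourierWigner ħ hhm hφc
  have hslice : ∀ x : RSpace ι, ∫⁻ y, ‖fourierWigner ħ h φ (x, y)‖ₑ ^ 2 =
      ENNReal.ofReal ((ħ ^ Fintype.card ι)⁻¹) * ∫⁻ t, ‖h t‖ₑ ^ 2 * ‖φ (t - x)‖ₑ ^ 2 := fun x => by
    have hψ2 : MemLp (fun t => conj (φ (t - x))) 2 :=
      (hφ.memLp.comp_measurePreserving (measurePreserving_sub_right volume x)).star
    obtain ⟨C, hC⟩ := hφ.decay.bounded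
    have hi1 : Integrable (fun t => h t * conj (φ (t - x))) := (Lp.memLp h).integrable_mul hψ2
    have hi2 : MemLp (fun t => h t * conj (φ (t - x))) 2 :=
      (Lp.memLp h).of_le_mul (c := C) hi1.1 (Filter.Eventually.of_forall fun t => by
        rw [norm_mul, RCLike.norm_conj, mul_comm]
        gcongr
        exact hC _)
    calc _ = ∫⁻ y, ‖𝓕⁻ (fun t => h t * conj (φ (t - x))) (ħ • y)‖ₑ ^ 2 := by
          congr 1
          ext y
          rw [← ofReal_norm, norm_fourierWigner, ofReal_norm]
      _ = _ := by
          rw [lintegral_comp_smul_of_pos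
            (f := fun y => ‖𝓕⁻ (fun t => h t * conj (φ (t - x))) y‖ₑ ^ 2) _ hħ,
            lintegral_fourierInv_sq hi1 hi2]
          · congr 2
            ext t
            rw [← mul_pow, enorm_mul, RCLike.enorm_conj]
          · exact (continuous_fourierInv hi1).measurable.enorm.pow_const 2 |>.aemeasurable
  rw [Measure.volume_eq_prod, lintegral_prod _ (hm.measurable.enorm.pow_const 2).aemeasurable]
  simp_rw [hslice]
  have hmm : Measurable (Function.uncurry fun (x t : RSpace ι) => ‖h t‖ₑ ^ 2 * ‖φ (t - x)‖ₑ ^ 2) := by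
    have h1 : Measurable fun p : RSpace ι × RSpace ι => ‖h p.2‖ₑ :=
      (hhm.measurable.comp measurable_snd).enorm
    have h2 : Measurable fun p : RSpace ι × RSpace ι => ‖φ (p.2 - p.1)‖ₑ :=
      (hφc.measurable.comp (measurable_snd.sub measurable_fst)).enorm
    exact (h1.pow_const 2).mul (h2.pow_const 2)
  have hmm' : Measurable fun x => ∫⁻ t, ‖h t‖ₑ ^ 2 * ‖φ (t - x)‖ₑ ^ 2 := hmm.lintegral_prod_right'
  rw [lintegral_const_mul _ hmm', lintegral_lintegral_swap hmm.aemeasurable]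
  congr 1
  have hc : Measurable fun t => ‖φ t‖ₑ ^ 2 := hφc.measurable.enorm.pow_const 2
  rw [← lintegral_mul_const _ (hhm.measurable.enorm.pow_const 2)]
  congr 1
  ext t
  have hc' : Measurable fun x => ‖φ (t - x)‖ₑ ^ 2 := hc.comp (measurable_const.sub measurable_id)
  rw [lintegral_const_mul _ hc']
  congr 1
  exact (lintegral_sub_left_eq_self (fun t => ‖φ t‖ₑ ^ 2) t)

theorem memLp_fourierWigner {ħ : ℝ} (hħ : 0 < ħ) {φ : RSpace ι → ℂ} (hφ : RapidFourier φ)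
    (h : L2R ι) : MemLp (fourierWigner ħ h φ) 2 := by
  refine ⟨(stronglyMeasurable_fourierWigner ħ (Lp.stronglyMeasurable h)
    hφ.continuous).aestronglyMeasurable, ?_⟩
  have key : ∀ {E : Type _} [MeasurableSpace E] {μ : Measure E} {g : E → ℂ},
      eLpNorm g 2 μ < ⊤ ↔ ∫⁻ x, ‖g x‖ₑ ^ 2 ∂μ < ⊤ := by
    intro E _ μ g
    rw [eLpNorm_lt_top_iff_lintegral_rpow_enorm_lt_top (by norm_num) (by norm_num)]
    simp
  rw [key, lintegral_fourierWigner_sq hħ hφ]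
  exact ENNReal.mul_lt_top ENNReal.ofReal_lt_top
    (ENNReal.mul_lt_top (key.1 (Lp.memLp h).2) (key.1 hφ.memLp.2))

/-- The isometry `h ↦ ħ^(m/2) W(h, φ_τ)` of `L²(ℝᵐ)` into `L²(ℝ²ᵐ)`. -/
def wignerIsometry {ħ τ : ℝ} (hħ : 0 < ħ) (hτ : 0 < τ) : L2R ι →ₗᵢ[ℂ] L2P ι where
  toFun h := ((√(ħ ^ Fintype.card ι) : ℝ) : ℂ) •
    (memLp_fourierWigner hħ (rapidFourier_squeezedGaussian hħ hτ) h).toLp _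
  map_add' f g := by
    rw [← smul_add, ← MemLp.toLp_add]
    refine congrArg (fun F : L2P ι => ((√(ħ ^ Fintype.card ι) : ℝ) : ℂ) • F)
      (MemLp.toLp_congr _ _ (Filter.Eventually.of_forall fun z => ?_))
    simp only [Pi.add_apply, fourierWigner_eq_inner ħ (rapidFourier_squeezedGaussian hħ hτ)]
    rw [inner_add_right]
  map_smul' c f := by
    rw [RingHom.id_apply, smul_comm c]
    refine congrArg (fun F : L2P ι => ((√(ħ ^ Fintype.card ι) : ℝ) : ℂ) • F) ?_
    rw [← MemLp.toLp_const_smul]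
    refine MemLp.toLp_congr _ _ (Filter.Eventually.of_forall fun z => ?_)
    simp only [Pi.smul_apply, fourierWigner_eq_inner ħ (rapidFourier_squeezedGaussian hħ hτ)]
    rw [inner_smul_right, smul_eq_mul]
  norm_map' h := by
    change ‖((√(ħ ^ Fintype.card ι) : ℝ) : ℂ) •
      (memLp_fourierWigner hħ (rapidFourier_squeezedGaussian hħ hτ) h).toLp _‖ = ‖h‖
    have e2 : ∀ {E : Type _} [MeasurableSpace E] {μ : Measure E} {g : E → ℂ},
        eLpNorm g 2 μ = (∫⁻ x, ‖g x‖ₑ ^ 2 ∂μ) ^ (1 / 2 : ℝ) := by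
      intro E _ μ g
      rw [eLpNorm_eq_lintegral_rpow_enorm_toReal (by norm_num) (by norm_num)]
      simp
    rw [norm_smul, Lp.norm_toLp, Lp.norm_def, e2, e2, lintegral_fourierWigner_sq hħ
      (rapidFourier_squeezedGaussian hħ hτ), lintegral_squeezedGaussian_sq hħ hτ, mul_one,
      ENNReal.mul_rpow_of_nonneg _ _ (by norm_num), ENNReal.toReal_mul, ← mul_assoc,
      ENNReal.ofReal_rpow_of_nonneg (by positivity) (by norm_num),
      ENNReal.toReal_ofReal (by positivity), ← Real.sqrt_eq_rpow, norm_real,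
      Real.norm_of_nonneg (by positivity), ← Real.sqrt_mul (by positivity),
      mul_inv_cancel₀ (by positivity), Real.sqrt_one, one_mul]

variable {ħ τ ς : ℝ}

theorem coeFn_wignerIsometry (hħ : 0 < ħ) (hτ : 0 < τ) (h : L2R ι) :
    ⇑(wignerIsometry hħ hτ h) =ᵐ[volume] fun z =>
      ((√(ħ ^ Fintype.card ι) : ℝ) : ℂ) * fourierWigner ħ h (squeezedGaussian ħ τ) z := by
  have h1 := Lp.coeFn_smul ((√(ħ ^ Fintype.card ι) : ℝ) : ℂ)
    ((memLp_fourierWigner hħ (rapidFourier_squeezedGaussian hħ hτ) h).toLp _)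
  refine h1.trans ?_
  filter_upwards [(memLp_fourierWigner hħ (rapidFourier_squeezedGaussian hħ hτ) h).coeFn_toLp]
    with z hz
  rw [Pi.smul_apply, hz, smul_eq_mul]

theorem wignerIsometry_eq_smul (hħ : 0 < ħ) (hτ : 0 < τ) (h : L2R ι) (F : L2P ι)
    (hF : ⇑F =ᵐ[volume] fourierWigner ħ h (squeezedGaussian ħ τ)) :
    wignerIsometry hħ hτ h = ((√(ħ ^ Fintype.card ι) : ℝ) : ℂ) • F := by
  refine Lp.ext ((coeFn_wignerIsometry hħ hτ h).trans ?_)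
  filter_upwards [Lp.coeFn_smul ((√(ħ ^ Fintype.card ι) : ℝ) : ℂ) F, hF] with z h1 h2
  rw [h1, Pi.smul_apply, h2, smul_eq_mul]

theorem sqrt_pow_ne_zero (hħ : 0 < ħ) : ((√(ħ ^ Fintype.card ι) : ℝ) : ℂ) ≠ 0 := by
  have : 0 < √(ħ ^ Fintype.card ι) := by positivity
  exact_mod_cast this.ne'

/-- The generating set is already the range of a linear isometry on a complete space, hence a closed
subspace, so span and closure add nothing. -/
theorem preFSB_eq_range (hħ : 0 < ħ) (hτ : 0 < τ) :
    preFSB ι ħ τ = LinearMap.range (wignerIsometry (ι := ι) hħ hτ).toLinearMap := by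
  have hspan : Submodule.span ℂ {F : L2P ι | ∃ h : L2R ι,
      ⇑F =ᵐ[volume] fourierWigner ħ h (squeezedGaussian ħ τ)} =
      LinearMap.range (wignerIsometry (ι := ι) hħ hτ).toLinearMap := by
    refine le_antisymm (Submodule.span_le.2 ?_) ?_
    · rintro F ⟨h, hF⟩
      refine ⟨((√(ħ ^ Fintype.card ι) : ℝ) : ℂ)⁻¹ • h, ?_⟩
      rw [map_smul]
      change _ • wignerIsometry hħ hτ h = F
      rw [wignerIsometry_eq_smul hħ hτ h F hF, inv_smul_smul₀ (sqrt_pow_ne_zero hħ)]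
    · rintro _ ⟨h, rfl⟩
      exact Submodule.smul_mem _ _ (Submodule.subset_span
        ⟨h, (memLp_fourierWigner hħ (rapidFourier_squeezedGaussian hħ hτ) h).coeFn_toLp⟩)
  rw [preFSB, hspan]
  refine IsClosed.submodule_topologicalClosure_eq ?_
  have := (wignerIsometry (ι := ι) hħ hτ).isometry.isClosedEmbedding.isClosed_range
  exact this

/-- The unitary `h ↦ ħ^(m/2) W(h, φ_τ)` of `L²(ℝᵐ)` onto `F_τ`. -/
def wignerEquiv (hħ : 0 < ħ) (hτ : 0 < τ) : L2R ι ≃ₗᵢ[ℂ] preFSB ι ħ τ :=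
  (wignerIsometry hħ hτ).equivRange.trans
    (LinearIsometryEquiv.ofEq _ _ (preFSB_eq_range hħ hτ).symm)

theorem coe_wignerEquiv (hħ : 0 < ħ) (hτ : 0 < τ) (h : L2R ι) :
    (wignerEquiv hħ hτ h : L2P ι) = wignerIsometry hħ hτ h := rfl

/-- The unitary `W(h, φ_ς) ↦ W(h, φ_τ)` of `F_ς` onto `F_τ`. -/
def windowChange (hħ : 0 < ħ) (hτ : 0 < τ) (hς : 0 < ς) : preFSB ι ħ ς ≃ₗᵢ[ℂ] preFSB ι ħ τ :=
  (wignerEquiv hħ hς).symm.trans (wignerEquiv hħ hτ)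

theorem windowChange_fourierWigner (hħ : 0 < ħ) (hτ : 0 < τ) (hς : 0 < ς) (h : L2R ι)
    (F : preFSB ι ħ ς)
    (hF : ⇑(F : L2P ι) =ᵐ[volume] fourierWigner ħ h (squeezedGaussian ħ ς)) :
    ⇑(windowChange hħ hτ hς F : L2P ι) =ᵐ[volume] fourierWigner ħ h (squeezedGaussian ħ τ) := by
  have hc := sqrt_pow_ne_zero (ι := ι) hħ
  have h1 : wignerEquiv hħ hς h = ((√(ħ ^ Fintype.card ι) : ℝ) : ℂ) • F :=
    Subtype.ext (wignerIsometry_eq_smul hħ hς h F hF)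
  have h2 : F = wignerEquiv hħ hς (((√(ħ ^ Fintype.card ι) : ℝ) : ℂ)⁻¹ • h) := by
    rw [map_smul, h1, inv_smul_smul₀ hc]
  rw [h2, windowChange, LinearIsometryEquiv.trans_apply, LinearIsometryEquiv.symm_apply_apply,
    coe_wignerEquiv, map_smul]
  filter_upwards [Lp.coeFn_smul ((√(ħ ^ Fintype.card ι) : ℝ) : ℂ)⁻¹ (wignerIsometry hħ hτ h),
    coeFn_wignerIsometry hħ hτ h] with z hz1 hz2
  rw [hz1, Pi.smul_apply, hz2, smul_eq_mul, inv_mul_cancel_left₀ hc]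

/-- The adjoint `J_ς J_τ*` of `F ↦ U P_ς F`. -/
def windowChangeAdjoint (hħ : 0 < ħ) (hτ : 0 < τ) (hς : 0 < ς) : L2P ι →L[ℂ] L2P ι :=
  (wignerIsometry hħ hς).toContinuousLinearMap ∘L
    (wignerIsometry hħ hτ).toContinuousLinearMap.adjoint

/-- With `P_ς F = J_ς k` one has `⟨U P_ς F, G⟩ = ⟨J_τ k, G⟩ = ⟨k, J_τ* G⟩ = ⟨J_ς k, J_ς J_τ* G⟩`,
and the projection may be dropped against an element of `F_ς`. -/
theorem inner_windowChange_proj (hħ : 0 < ħ) (hτ : 0 < τ) (hς : 0 < ς) (F G : L2P ι) :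
    inner ℂ G (windowChange hħ hτ hς ((preFSB ι ħ ς).orthogonalProjectionOnto F) : L2P ι) =
      inner ℂ (windowChangeAdjoint hħ hτ hς G) F := by
  set k := (wignerEquiv hħ hς).symm ((preFSB ι ħ ς).orthogonalProjectionOnto F) with hk
  have hk' : (preFSB ι ħ ς).orthogonalProjectionOnto F = wignerEquiv hħ hς k := by
    rw [hk, LinearIsometryEquiv.apply_symm_apply]
  set g := (wignerIsometry hħ hτ).toContinuousLinearMap.adjoint G with hg
  have h1 : inner ℂ G (wignerIsometry hħ hτ k) = inner ℂ g k :=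
    (ContinuousLinearMap.adjoint_inner_left (wignerIsometry hħ hτ).toContinuousLinearMap k G).symm
  have h2 : inner ℂ (wignerEquiv hħ hς g : L2P ι)
      ((preFSB ι ħ ς).orthogonalProjectionOnto F : L2P ι) = inner ℂ (wignerEquiv hħ hς g : L2P ι) F := by
    rw [← Submodule.coe_inner]
    exact Submodule.inner_orthogonalProjectionOnto_eq_of_mem_left (wignerEquiv hħ hς g) F
  change inner ℂ G (wignerIsometry hħ hτ k) = inner ℂ (wignerEquiv hħ hς g : L2P ι) F
  rw [h1, ← h2, hk', ← Submodule.coe_inner, LinearIsometryEquiv.inner_map_map]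

/-! ### Covariance and the reproducing kernel -/

theorem schrodingerRep_sub_mul_conj (ħ : ℝ) (z w : Phase ι) (f φ : RSpace ι → ℂ) (t : RSpace ι) :
    schrodingerRep ħ z f (t + z.1) * conj (schrodingerRep ħ w φ (t + z.1)) =
      cexp (Real.pi * I * ħ * (symplForm z w : ℂ)) *
        (f t * conj (schrodingerRep ħ (w - z) φ t)) := by
  simp only [schrodingerRep, map_mul, ← Complex.exp_conj, symplForm, add_sub_cancel_right,
    Prod.fst_sub, Prod.snd_sub]
  rw [show t + z.1 - w.1 = t - (w.1 - z.1) by abel]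
  have hexp : ∀ a b c d : ℂ, a + b = c + d →
      cexp a * f t * (cexp b * conj (φ (t - (w.1 - z.1)))) =
      cexp c * (f t * (cexp d * conj (φ (t - (w.1 - z.1))))) := by
    intro a b c d h
    have : cexp a * cexp b = cexp c * cexp d := by rw [← Complex.exp_add, ← Complex.exp_add, h]
    linear_combination f t * conj (φ (t - (w.1 - z.1))) * this
  refine hexp _ _ _ _ ?_
  simp only [conj_ofReal, conj_I, inner_sub_left, inner_sub_right, inner_add_right]
  rw [real_inner_comm z.1 z.2, real_inner_comm z.1 w.2]
  push_cast
  ring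

/-- The Fourier–Wigner transform intertwines `ρ` and `Λ`: after translating `t` by `x` the
integrands agree, the cocycle `exp(πiħω)` being the phase in `Λ`. -/
theorem fourierWigner_schrodingerRep (ħ : ℝ) (z : Phase ι) (f φ : RSpace ι → ℂ) :
    fourierWigner ħ (schrodingerRep ħ z f) φ = leftAction ħ z (fourierWigner ħ f φ) := by
  ext w
  rw [leftAction, fourierWigner, fourierWigner, ← integral_const_mul,
    ← integral_add_right_eq_self _ z.1]
  exact integral_congr_ae (Filter.Eventually.of_forall fun t =>
    schrodingerRep_sub_mul_conj ħ z w f φ t)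

/-- The value at `z` is `ħ^(m/2) ⟨J_τ* G, ρ(z)φ_ς⟩ = ħ^(m/2) ⟨G, J_τ ρ(z)φ_ς⟩`, and covariance gives
`J_τ ρ(z)φ_ς = ħ^(m/2) Λ(z)Φ_τς`. The two normalisations make up `ħ^m`. -/
theorem coeFn_windowChangeAdjoint (hħ : 0 < ħ) (hτ : 0 < τ) (hς : 0 < ς) (G : L2P ι) :
    ⇑(windowChangeAdjoint hħ hτ hς G) =ᵐ[volume] fun z =>
      ((ħ ^ Fintype.card ι : ℝ) : ℂ) * ∫ w, G w * conj (leftAction ħ z (mixedGaussian ħ τ ς) w) := by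
  set g := (wignerIsometry hħ hτ).toContinuousLinearMap.adjoint G with hg
  refine (coeFn_wignerIsometry hħ hς g).trans (Filter.Eventually.of_forall fun z => ?_)
  have hgs := rapidFourier_squeezedGaussian (ι := ι) hħ hς
  have hmem := hgs.memLp_schrodingerRep ħ z
  simp only
  rw [fourierWigner_eq_inner ħ hgs, hg, ContinuousLinearMap.adjoint_inner_right]
  change _ * inner ℂ (wignerIsometry hħ hτ (hmem.toLp _)) G = _
  rw [L2.inner_def, ← integral_const_mul, ← integral_const_mul]
  refine integral_congr_ae ((coeFn_wignerIsometry hħ hτ (hmem.toLp _)).mono fun w hw => ?_)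
  simp only [RCLike.inner_apply]
  rw [hw, fourierWigner_congr_ae ħ hmem.coeFn_toLp, fourierWigner_schrodingerRep, map_mul,
    conj_ofReal, mixedGaussian]
  have : ((√(ħ ^ Fintype.card ι) : ℝ) : ℂ) * ((√(ħ ^ Fintype.card ι) : ℝ) : ℂ) =
      ((ħ ^ Fintype.card ι : ℝ) : ℂ) := by
    rw [← ofReal_mul, Real.mul_self_sqrt (by positivity)]
  rw [← this]
  ring

end

section

variable {ι : Type*} [Fintype ι]

/-! ### The symplectic Fourier transform of a Fourier–Wigner transform -/

/-- Fourier inversion in `y`: the phase of `W` and the extra character combine into evaluation at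
the midpoint `(x + X)/2`. -/
theorem integral_fourierWigner_mul_cexp {ħ : ℝ} (hħ : 0 < ħ) {f g : RSpace ι → ℂ}
    (hf : RapidFourier f) (hg : RapidFourier g) (x X : RSpace ι)
    (hint : Integrable fun y => fourierWigner ħ g f (x, y)) :
    ∫ y, fourierWigner ħ g f (x, y) * cexp (-(Real.pi * I * ħ * (inner ℝ X y : ℝ))) =
      ((ħ ^ Fintype.card ι : ℝ) : ℂ)⁻¹ *
        (g ((2⁻¹ : ℝ) • (x + X)) * conj (f ((2⁻¹ : ℝ) • (x + X) - x))) := by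
  set q : RSpace ι → ℂ := fun t => g t * conj (f (t - x)) with hq
  have hqc : Continuous q := by
    have := hf.continuous
    have := hg.continuous
    fun_prop
  have hqi : Integrable q := by
    obtain ⟨C, hC⟩ := hf.decay.bounded
    refine (hg.integrable.norm.mul_const C).mono' hqc.aestronglyMeasurable
      (Filter.Eventually.of_forall fun t => ?_)
    rw [hq, norm_mul, RCLike.norm_conj]
    gcongr
    exact hC _
  -- The hypothesis for inversion comes from the slice of `W`, which has the same modulus as `𝓕⁻ q`
  -- at `ħ y`.
  have hFi : Integrable (𝓕⁻ q) := by
    rw [← integrable_comp_smul_iff volume _ hħ.ne']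
    refine hint.norm.mono' ?_ (Filter.Eventually.of_forall fun y =>
      (norm_fourierWigner ħ g f (x, y)).ge)
    exact ((continuous_fourierInv hqi).comp (continuous_const_smul ħ)).aestronglyMeasurable
  have hFi' : Integrable (𝓕 q) := hFi.comp_neg.congr (Filter.Eventually.of_forall fun w => by
    simp only [Real.fourierInv_eq_fourier_neg, neg_neg])
  have hinv : 𝓕 (𝓕⁻ q) ((2⁻¹ : ℝ) • (x + X)) = q ((2⁻¹ : ℝ) • (x + X)) :=
    congrFun (hqc.fourier_fourierInv_eq hqi hFi') _
  rw [Real.fourier_eq'] at hinv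
  have hsc := Measure.integral_comp_smul_of_nonneg (volume : Measure (RSpace ι))
    (fun η => cexp (((-2 * Real.pi * inner ℝ η ((2⁻¹ : ℝ) • (x + X)) : ℝ) : ℂ) * I) • 𝓕⁻ q η)
    ħ (hR := hħ.le)
  rw [hinv, finrank_euclideanSpace, real_smul] at hsc
  rw [← ofReal_inv]
  refine Eq.trans ?_ hsc
  congr 1
  ext y
  rw [fourierWigner_eq_fourierInv, mul_right_comm, ← Complex.exp_add, smul_eq_mul]
  congr 2
  simp only [inner_smul_right, inner_add_right, real_inner_comm x, real_inner_comm X]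
  push_cast
  ring

/-- After inversion in `y` the arguments are `(x + z₁)/2` and `(z₁ - x)/2`. The substitution `x = 2t
- z₁` turns them into `t` and `-(t - z₁)`, whence the reflected window. Its Jacobian `2^m` and the
`ħ^(-m)` from inversion cancel the prefactor `(ħ/2)^m`. -/
theorem symplFourier_fourierWigner {ħ : ℝ} (hħ : 0 < ħ) {f g : RSpace ι → ℂ}
    (hf : RapidFourier f) (hg : RapidFourier g) :
    symplFourier ħ (fourierWigner ħ g f) = fourierWigner ħ g (fun t => f (-t)) := by
  ext z
  have hW := integrable_fourierWigner hħ hg hf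
  have hWe : Integrable (fun w : Phase ι => fourierWigner ħ g f w *
      cexp (Real.pi * I * ħ * (symplForm w z : ℂ))) (volume.prod volume) := by
    refine hW.norm.mono' ?_ (Filter.Eventually.of_forall fun w => ?_)
    · have := continuous_fourierWigner ħ hg hf
      unfold symplForm
      exact Continuous.aestronglyMeasurable (by fun_prop)
    · rw [norm_mul, Complex.norm_exp]
      simp
  have hslice : ∀ᵐ x : RSpace ι, Integrable fun y => fourierWigner ħ g f (x, y) :=
    Integrable.prod_right_ae (μ := volume) (ν := volume) hW
  rw [symplFourier, Measure.volume_eq_prod, integral_prod _ hWe]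
  have h1 : ∀ᵐ x : RSpace ι, ∫ y, fourierWigner ħ g f (x, y) *
      cexp (Real.pi * I * ħ * (symplForm (x, y) z : ℂ)) = ((ħ ^ Fintype.card ι : ℝ) : ℂ)⁻¹ *
        (cexp (Real.pi * I * ħ * (inner ℝ x z.2 : ℝ)) * (g ((2⁻¹ : ℝ) • (x + z.1)) *
          conj (f ((2⁻¹ : ℝ) • (x + z.1) - x)))) := by
    filter_upwards [hslice] with x hx
    rw [mul_left_comm, ← integral_fourierWigner_mul_cexp hħ hf hg x z.1 hx, ← integral_const_mul]
    congr 1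
    ext y
    rw [mul_left_comm, ← Complex.exp_add]
    congr 2
    simp only [symplForm]
    push_cast
    ring
  rw [integral_congr_ae h1, integral_const_mul]
  have h2 := Measure.integral_comp_smul_of_nonneg (volume : Measure (RSpace ι))
    (fun x => cexp (Real.pi * I * ħ * (inner ℝ (x - z.1) z.2 : ℝ)) * (g ((2⁻¹ : ℝ) • x) *
          conj (f ((2⁻¹ : ℝ) • x - (x - z.1))))) 2 (hR := by norm_num)
  have h3 := integral_add_right_eq_self (μ := (volume : Measure (RSpace ι)))
    (fun x => cexp (Real.pi * I * ħ * (inner ℝ (x - z.1) z.2 : ℝ)) * (g ((2⁻¹ : ℝ) • x) *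
          conj (f ((2⁻¹ : ℝ) • x - (x - z.1))))) z.1
  simp only [add_sub_cancel_right] at h3
  rw [h3]
  have h4 : fourierWigner ħ g (fun t => f (-t)) z = ∫ x : RSpace ι,
      cexp (Real.pi * I * ħ * (inner ℝ ((2 : ℝ) • x - z.1) z.2 : ℝ)) *
        (g ((2⁻¹ : ℝ) • (2 : ℝ) • x) * conj (f ((2⁻¹ : ℝ) • (2 : ℝ) • x - ((2 : ℝ) • x - z.1)))) := by
    rw [fourierWigner]
    congr 1
    ext t
    rw [inv_smul_smul₀ two_ne_zero, schrodingerRep, map_mul, ← Complex.exp_conj]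
    rw [show t - ((2 : ℝ) • t - z.1) = -(t - z.1) by rw [two_smul]; abel]
    rw [mul_left_comm]
    congr 2
    simp only [real_inner_comm z.2, inner_sub_right, inner_smul_right, map_mul, conj_ofReal, conj_I]
    push_cast
    ring
  rw [h4, h2, finrank_euclideanSpace, real_smul]
  simp only [← mul_assoc]
  congr 1
  have hne : (ħ : ℂ) ≠ 0 := by exact_mod_cast hħ.ne'
  push_cast
  rw [div_pow]
  field_simp

/-! ### Splitting of coordinates -/

/-- The identification of `(u, v) ∈ ℝᵐ × ℝᵐ` with a vector of `ℝ²ᵐ`. -/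
def joinEquiv (ι : Type*) [Fintype ι] : Phase ι ≃L[ℝ] RSpace (ι ⊕ ι) :=
  LinearEquiv.toContinuousLinearEquiv
  { toFun := fun z => WithLp.toLp 2 (Sum.elim z.1 z.2)
    invFun := fun s => (part₁ s, part₂ s)
    map_add' := fun z w => by ext (i | i) <;> simp
    map_smul' := fun c z => by ext (i | i) <;> simp
    left_inv := fun z => by ext i <;> simp [part₁, part₂]
    right_inv := fun s => by ext (i | i) <;> simp [part₁, part₂] }

theorem joinEquiv_symm_apply (s : RSpace (ι ⊕ ι)) :
    (joinEquiv ι).symm s = (part₁ s, part₂ s) := rfl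

@[simp] theorem part₁_joinEquiv (z : Phase ι) : part₁ (joinEquiv ι z) = z.1 := rfl

@[simp] theorem part₂_joinEquiv (z : Phase ι) : part₂ (joinEquiv ι z) = z.2 := rfl

theorem continuous_part₁ : Continuous (part₁ (ι := ι)) :=
  continuous_fst.comp (joinEquiv ι).symm.continuous

theorem continuous_part₂ : Continuous (part₂ (ι := ι)) :=
  continuous_snd.comp (joinEquiv ι).symm.continuous

theorem inner_eq_inner_part (s t : RSpace (ι ⊕ ι)) :
    (inner ℝ s t : ℝ) = inner ℝ (part₁ s) (part₁ t) + inner ℝ (part₂ s) (part₂ t) := by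
  simp [PiLp.inner_apply, part₁, part₂]

theorem measurePreserving_joinEquiv : MeasurePreserving (joinEquiv ι) := by
  have h1 := (PiLp.volume_preserving_ofLp ι).prod (PiLp.volume_preserving_ofLp ι)
  have h2 := volume_measurePreserving_sumPiEquivProdPi_symm (fun _ : ι ⊕ ι => ℝ)
  have h3 := PiLp.volume_preserving_toLp (ι ⊕ ι)
  convert! h3.comp (h2.comp h1) using 1

/-- The map `(x, y) ↦ (α y, β x)`. -/
def scaleSwap {α β : ℝ} (hα : 0 < α) (hβ : 0 < β) : Phase ι ≃L[ℝ] Phase ι :=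
  LinearEquiv.toContinuousLinearEquiv
  { toFun := fun z => (α • z.2, β • z.1)
    invFun := fun w => (β⁻¹ • w.2, α⁻¹ • w.1)
    map_add' := fun z w => by simp
    map_smul' := fun c z => by simp [smul_comm c]
    left_inv := fun z => by simp [hα.ne', hβ.ne']
    right_inv := fun s => by simp [hα.ne', hβ.ne'] }

theorem scaleSwap_apply {α β : ℝ} (hα : 0 < α) (hβ : 0 < β) (z : Phase ι) :
    scaleSwap hα hβ z = (α • z.2, β • z.1) := rfl

theorem map_scaleSwap {α β : ℝ} (hα : 0 < α) (hβ : 0 < β) :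
    Measure.map (scaleSwap hα hβ) (volume : Measure (Phase ι)) =
      ENNReal.ofReal ((α * β) ^ Fintype.card ι)⁻¹ • volume := by
  have h1 : ∀ r : ℝ, 0 < r → Measure.map (r • ·) (volume : Measure (RSpace ι)) =
      ENNReal.ofReal (r ^ Fintype.card ι)⁻¹ • volume := fun r hr => by
    rw [Measure.map_addHaar_smul _ hr.ne', finrank_euclideanSpace, abs_of_pos (by positivity)]
  have h2 : ⇑(scaleSwap (ι := ι) hα hβ) = Prod.map (α • ·) (β • ·) ∘ Prod.swap := rfl
  rw [h2, ← Measure.map_map (by fun_prop) measurable_swap, Measure.volume_eq_prod,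
    Measure.prod_swap, ← Measure.map_prod_map _ _ (by fun_prop) (by fun_prop), h1 α hα, h1 β hβ,
    Measure.prod_smul_left, Measure.prod_smul_right, smul_smul,
    ← ENNReal.ofReal_mul (by positivity), mul_pow, mul_inv]

theorem integral_comp_scaleSwap {α β : ℝ} (hα : 0 < α) (hβ : 0 < β) (F : Phase ι → ℂ) :
    ∫ z, F (scaleSwap hα hβ z) = (((α * β) ^ Fintype.card ι : ℝ) : ℂ)⁻¹ * ∫ z, F z := by
  have h' : Measure.map (scaleSwap hα hβ).toHomeomorph (volume : Measure (Phase ι)) =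
      ENNReal.ofReal ((α * β) ^ Fintype.card ι)⁻¹ • volume := map_scaleSwap (ι := ι) hα hβ
  have h := (scaleSwap hα hβ).toHomeomorph.measurableEmbedding.integral_map
    (μ := (volume : Measure (Phase ι))) F
  rw [h', integral_smul_measure, ENNReal.toReal_ofReal (by positivity), real_smul, ofReal_inv] at h
  exact h.symm

end

section

variable {ι : Type*} [Fintype ι]

/-! ### Weighted composition operators -/

section WeightedComp

variable {α β : Type*} [MeasurableSpace α] [MeasurableSpace β] {μ : Measure α} {ν : Measure β}

theorem ofReal_sq_smul_map {c : ℝ} (hc : 0 < c) {L : α → β}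
    (hL : Measure.map L μ = ENNReal.ofReal (c ^ 2)⁻¹ • ν) :
    ν = ENNReal.ofReal (c ^ 2) • Measure.map L μ := by
  rw [hL, smul_smul, ← ENNReal.ofReal_mul (by positivity), mul_inv_cancel₀ (by positivity),
    ENNReal.ofReal_one, one_smul]

/-- The constant `|u|² = c²` compensates the Jacobian `c⁻²` of `L`. -/
theorem eLpNorm_weightedComp {c : ℝ} (hc : 0 < c) {L : α ≃ᵐ β}
    (hL : Measure.map L μ = ENNReal.ofReal (c ^ 2)⁻¹ • ν) {u : α → ℂ} (hu : ∀ x, ‖u x‖ = c)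
    (f : β → ℂ) : eLpNorm (fun x => u x * f (L x)) 2 μ = eLpNorm f 2 ν := by
  have h1 : eLpNorm (fun x => u x * f (L x)) 2 μ = eLpNorm ((c : ℂ) • (f ∘ L)) 2 μ := by
    refine eLpNorm_congr_norm_ae (Filter.Eventually.of_forall fun x => ?_)
    simp [hu, abs_of_pos hc]
  rw [h1, eLpNorm_const_smul, ← L.measurableEmbedding.eLpNorm_map_measure]
  conv_rhs => rw [ofReal_sq_smul_map hc hL]
  rw [eLpNorm_smul_measure_of_ne_top (by norm_num), ← ofReal_norm, norm_real,
    Real.norm_of_nonneg hc.le, smul_eq_mul]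
  congr 1
  rw [one_div, ENNReal.toReal_inv, ENNReal.toReal_ofNat, ← one_div, ENNReal.ofReal_rpow_of_nonneg (by positivity) (by norm_num),
    ← Real.sqrt_eq_rpow, Real.sqrt_sq hc.le]

theorem memLp_weightedComp {c : ℝ} (hc : 0 < c) {L : α ≃ᵐ β}
    (hL : Measure.map L μ = ENNReal.ofReal (c ^ 2)⁻¹ • ν) {u : α → ℂ} (hum : Measurable u)
    (hu : ∀ x, ‖u x‖ = c) {f : β → ℂ} (hf : MemLp f 2 ν) :
    MemLp (fun x => u x * f (L x)) 2 μ := by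
  have hq : Measure.QuasiMeasurePreserving L μ ν :=
    ⟨L.measurable, by rw [hL]; exact Measure.smul_absolutelyContinuous⟩
  exact ⟨hum.aestronglyMeasurable.mul (hf.1.comp_quasiMeasurePreserving hq),
    by rw [eLpNorm_weightedComp hc hL hu]; exact hf.2⟩

theorem map_refl_eq_smul : Measure.map (MeasurableEquiv.refl α) μ =
    ENNReal.ofReal (1 ^ 2)⁻¹ • μ := by
  rw [one_pow, inv_one, ENNReal.ofReal_one, one_smul]
  exact Measure.map_id

/-- The unitary operator `f ↦ u · (f ∘ L)`, where `|u|` is a constant matching the Jacobian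
of `L`. -/
def weightedComp {c : ℝ} (hc : 0 < c) (L : α ≃ᵐ β)
    (hL : Measure.map L μ = ENNReal.ofReal (c ^ 2)⁻¹ • ν) {u : α → ℂ} (hum : Measurable u)
    (hu : ∀ x, ‖u x‖ = c) : Lp ℂ 2 ν ≃ₗᵢ[ℂ] Lp ℂ 2 μ :=
  have hq : Measure.QuasiMeasurePreserving L μ ν :=
    ⟨L.measurable, by rw [hL]; exact Measure.smul_absolutelyContinuous⟩
  LinearIsometryEquiv.ofSurjective
  { toFun := fun f => (memLp_weightedComp hc hL hum hu (Lp.memLp f)).toLp _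
    map_add' := fun f g => by
      rw [← MemLp.toLp_add]
      refine MemLp.toLp_congr _ _ ?_
      filter_upwards [hq.ae (Lp.coeFn_add f g)] with x hx
      simp only [Pi.add_apply, hx]
      ring
    map_smul' := fun k f => by
      rw [RingHom.id_apply, ← MemLp.toLp_const_smul]
      refine MemLp.toLp_congr _ _ ?_
      filter_upwards [hq.ae (Lp.coeFn_smul k f)] with x hx
      simp only [Pi.smul_apply, hx, smul_eq_mul]
      ring
    norm_map' := fun f => by
      change ‖(memLp_weightedComp hc hL hum hu (Lp.memLp f)).toLp _‖ = ‖f‖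
      rw [Lp.norm_toLp, eLpNorm_weightedComp hc hL hu, Lp.norm_def] }
  (by
    intro g
    have hne : ∀ x, u x ≠ 0 := fun x h => hc.ne' (by rw [← hu x, h, norm_zero])
    have hmem : MemLp (fun y => (u (L.symm y))⁻¹ * g (L.symm y)) 2 ν := by
      rw [ofReal_sq_smul_map hc hL]
      refine MemLp.smul_measure ?_ ENNReal.ofReal_ne_top
      rw [L.measurableEmbedding.memLp_map_measure_iff]
      refine (Lp.memLp g).of_le_mul (c := c⁻¹) ?_ (Filter.Eventually.of_forall fun x => ?_)
      · simp only [Function.comp_def, MeasurableEquiv.symm_apply_apply]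
        exact hum.inv.aestronglyMeasurable.mul (Lp.aestronglyMeasurable g)
      · simp [hu]
    refine ⟨hmem.toLp _, ?_⟩
    refine Lp.ext ((memLp_weightedComp hc hL hum hu (Lp.memLp (hmem.toLp _))).coeFn_toLp.trans ?_)
    filter_upwards [hq.ae hmem.coeFn_toLp] with x hx
    rw [hx, L.symm_apply_apply, mul_inv_cancel_left₀ (hne x)])

theorem coeFn_weightedComp {c : ℝ} (hc : 0 < c) (L : α ≃ᵐ β)
    (hL : Measure.map L μ = ENNReal.ofReal (c ^ 2)⁻¹ • ν) {u : α → ℂ} (hum : Measurable u)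
    (hu : ∀ x, ‖u x‖ = c) (f : Lp ℂ 2 ν) :
    ⇑(weightedComp hc L hL hum hu f) =ᵐ[μ] fun x => u x * f (L x) :=
  (memLp_weightedComp hc hL hum hu (Lp.memLp f)).coeFn_toLp

end WeightedComp

/-! ### The unitary operator `V` -/

/-- All derivatives have modulus one. This is what lets multiplication by a chirp preserve Schwartz
functions. -/
theorem hasTemperateGrowth_cexp_mul_I : Function.HasTemperateGrowth fun x : ℝ => cexp (x * I) := by
  have h : ∀ n : ℕ, iteratedDeriv n (fun x : ℝ => cexp (x * I)) =
      fun x : ℝ => I ^ n * cexp (x * I) := by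
    intro n
    induction n with
    | zero => simp
    | succ n ih =>
      rw [iteratedDeriv_succ, ih]
      ext x
      have h1 : HasDerivAt (fun x : ℝ => cexp (x * I)) (cexp (x * I) * (1 * I)) x :=
        (((hasDerivAt_id (x : ℂ)).comp_ofReal).mul_const I).cexp
      rw [(h1.const_mul (I ^ n)).deriv]
      ring
  refine ⟨(Complex.ofRealCLM.contDiff.mul contDiff_const).cexp, fun n => ⟨0, 1, fun x => ?_⟩⟩
  rw [norm_iteratedFDeriv_eq_norm_iteratedDeriv, h]
  simp [Complex.norm_exp]

/-- The quadratic phase `exp (i r s₁·s₂)` on `ℝ²ᵐ`. -/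
def chirp (r : ℝ) (s : RSpace (ι ⊕ ι)) : ℂ :=
  cexp ((r * inner ℝ (part₁ s) (part₂ s) : ℝ) * I)

theorem norm_chirp (r : ℝ) (s : RSpace (ι ⊕ ι)) : ‖chirp r s‖ = 1 := norm_exp_ofReal_mul_I _

theorem hasTemperateGrowth_chirp (r : ℝ) :
    Function.HasTemperateGrowth (chirp (ι := ι) r) := by
  have h1 : Function.HasTemperateGrowth (part₁ (ι := ι)) :=
    ((ContinuousLinearMap.fst ℝ _ _).comp
      ((joinEquiv ι).symm : RSpace (ι ⊕ ι) →L[ℝ] Phase ι)).hasTemperateGrowth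
  have h2 : Function.HasTemperateGrowth (part₂ (ι := ι)) :=
    ((ContinuousLinearMap.snd ℝ _ _).comp
      ((joinEquiv ι).symm : RSpace (ι ⊕ ι) →L[ℝ] Phase ι)).hasTemperateGrowth
  have h3 := (innerSL ℝ (E := RSpace ι)).bilinear_hasTemperateGrowth h1 h2
  exact hasTemperateGrowth_cexp_mul_I.comp ((Function.HasTemperateGrowth.const r).mul h3)

variable {ħ ς : ℝ}

/-- The Jacobian factor `ħᵐ ς^(-m/2)`. -/
def jacobianFactor (m : ℕ) (ħ ς : ℝ) : ℝ := √((ħ * (ħ / ς)) ^ m)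

theorem jacobianFactor_pos (m : ℕ) (hħ : 0 < ħ) (hς : 0 < ς) : 0 < jacobianFactor m ħ ς := by
  unfold jacobianFactor
  positivity

theorem jacobianFactor_sq (m : ℕ) (hħ : 0 < ħ) (hς : 0 < ς) :
    jacobianFactor m ħ ς ^ 2 = (ħ * (ħ / ς)) ^ m :=
  Real.sq_sqrt (by positivity)

/-- The linear change of variables `(x, y) ↦ (ħ y, (ħ / ς) x)`. -/
def frequencyEquiv (hħ : 0 < ħ) (hς : 0 < ς) : Phase ι ≃L[ℝ] RSpace (ι ⊕ ι) :=
  (scaleSwap hħ (div_pos hħ hς)).trans (joinEquiv ι)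

theorem frequencyEquiv_apply (hħ : 0 < ħ) (hς : 0 < ς) (z : Phase ι) :
    frequencyEquiv hħ hς z = joinEquiv ι (ħ • z.2, (ħ / ς) • z.1) := rfl

theorem map_frequencyEquiv (hħ : 0 < ħ) (hς : 0 < ς) :
    Measure.map (frequencyEquiv hħ hς).toHomeomorph.toMeasurableEquiv (volume : Measure (Phase ι)) =
      ENNReal.ofReal (jacobianFactor (Fintype.card ι) ħ ς ^ 2)⁻¹ • volume := by
  have h : ⇑(frequencyEquiv (ι := ι) hħ hς).toHomeomorph.toMeasurableEquiv =
      joinEquiv ι ∘ scaleSwap hħ (div_pos hħ hς) := rfl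
  rw [h, ← Measure.map_map (joinEquiv ι).continuous.measurable
    (scaleSwap hħ (div_pos hħ hς)).continuous.measurable, map_scaleSwap, Measure.map_smul,
    measurePreserving_joinEquiv.map_eq, jacobianFactor_sq _ hħ hς]

/-- The weight `c exp (-π i ħ x·y)`, `c` the Jacobian factor. -/
def phaseWeight (ħ ς : ℝ) (z : Phase ι) : ℂ :=
  jacobianFactor (Fintype.card ι) ħ ς * cexp ((-(Real.pi * ħ * inner ℝ z.1 z.2) : ℝ) * I)

theorem norm_phaseWeight (hħ : 0 < ħ) (hς : 0 < ς) (z : Phase ι) :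
    ‖phaseWeight ħ ς z‖ = jacobianFactor (Fintype.card ι) ħ ς := by
  rw [phaseWeight, norm_mul, norm_exp_ofReal_mul_I, mul_one, norm_real,
    Real.norm_of_nonneg (jacobianFactor_pos _ hħ hς).le]

theorem continuous_phaseWeight : Continuous (phaseWeight (ι := ι) ħ ς) := by
  unfold phaseWeight
  fun_prop

/-- The unitary operator
`f ↦ c exp (-π i ħ x·y) ∫ f(s) exp (2 π i ħ (y·s₁ + x·s₂ / ς - s₁·s₂ / ς)) ds`
from `L²` of the doubled configuration space to `L²` of the phase space. -/
def phaseUnitary (hħ : 0 < ħ) (hς : 0 < ς) : L2R (ι ⊕ ι) ≃ₗᵢ[ℂ] L2P ι :=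
  ((weightedComp one_pos (MeasurableEquiv.refl _) map_refl_eq_smul
    (hasTemperateGrowth_chirp (-(2 * Real.pi * ħ / ς))).1.continuous.measurable
    (norm_chirp (-(2 * Real.pi * ħ / ς)))).trans
      (Lp.fourierTransformₗᵢ (RSpace (ι ⊕ ι)) ℂ).symm).trans
    (weightedComp (jacobianFactor_pos _ hħ hς)
      (frequencyEquiv hħ hς).toHomeomorph.toMeasurableEquiv (map_frequencyEquiv hħ hς)
      continuous_phaseWeight.measurable (norm_phaseWeight hħ hς))

/-- The kernel `exp (2 π i ħ (y·s₁ + x·s₂ / ς - s₁·s₂ / ς))`. -/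
def phaseKernel (ħ ς : ℝ) (z : Phase ι) (s : RSpace (ι ⊕ ι)) : ℂ :=
  cexp ((2 * Real.pi * ħ * (inner ℝ z.2 (part₁ s) + ς⁻¹ * inner ℝ z.1 (part₂ s) -
    ς⁻¹ * inner ℝ (part₁ s) (part₂ s)) : ℝ) * I)

theorem norm_phaseKernel (ħ ς : ℝ) (z : Phase ι) (s : RSpace (ι ⊕ ι)) :
    ‖phaseKernel ħ ς z s‖ = 1 := norm_exp_ofReal_mul_I _

theorem continuous_phaseKernel_right (ħ ς : ℝ) (z : Phase ι) :
    Continuous (phaseKernel ħ ς z) := by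
  have h1 := continuous_part₁ (ι := ι)
  have h2 := continuous_part₂ (ι := ι)
  unfold phaseKernel
  fun_prop

/-- The pointwise form of `phaseUnitary`. -/
def phaseIntegral (ħ ς : ℝ) (f : RSpace (ι ⊕ ι) → ℂ) (z : Phase ι) : ℂ :=
  phaseWeight ħ ς z * ∫ s, f s * phaseKernel ħ ς z s

/-- The product of a Schwartz function with a quadratic phase. -/
def chirpMul (r : ℝ) (f : 𝓢(RSpace (ι ⊕ ι), ℂ)) : 𝓢(RSpace (ι ⊕ ι), ℂ) :=
  SchwartzMap.smulLeftCLM ℂ (chirp r) f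

theorem chirpMul_apply (r : ℝ) (f : 𝓢(RSpace (ι ⊕ ι), ℂ)) (s : RSpace (ι ⊕ ι)) :
    chirpMul r f s = chirp r s * f s :=
  SchwartzMap.smulLeftCLM_apply_apply (hasTemperateGrowth_chirp r) f s

/-- The kernel is a chirp in `s` times the Fourier character at the frequency `(ħ y, ħ x/ς)`;
Schwartz regularity of the chirped function passes to decay in `z`. -/
theorem phaseIntegral_eq (hħ : 0 < ħ) (hς : 0 < ς) (f : 𝓢(RSpace (ι ⊕ ι), ℂ)) (z : Phase ι) :
    phaseIntegral ħ ς f z = phaseWeight ħ ς z *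
      (𝓕⁻ (chirpMul (-(2 * Real.pi * ħ / ς)) f)) (frequencyEquiv hħ hς z) := by
  rw [phaseIntegral, SchwartzMap.fourierInv_coe, Real.fourierInv_eq']
  congr 2
  ext s
  rw [chirpMul_apply, chirp, phaseKernel, smul_eq_mul, ← mul_assoc, ← Complex.exp_add, mul_comm]
  congr 2
  rw [inner_eq_inner_part, frequencyEquiv_apply, part₁_joinEquiv, part₂_joinEquiv,
    inner_smul_right, inner_smul_right, real_inner_comm (part₁ s), real_inner_comm (part₂ s)]
  push_cast
  ring

theorem coeFn_phaseUnitary (hħ : 0 < ħ) (hς : 0 < ς) (f : 𝓢(RSpace (ι ⊕ ι), ℂ)) :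
    ⇑(phaseUnitary hħ hς (f.toLp 2 volume)) =ᵐ[volume] phaseIntegral ħ ς f := by
  have h1 : weightedComp one_pos (MeasurableEquiv.refl _) map_refl_eq_smul
      (hasTemperateGrowth_chirp (-(2 * Real.pi * ħ / ς))).1.continuous.measurable
      (norm_chirp (-(2 * Real.pi * ħ / ς))) (f.toLp 2 volume) =
      (chirpMul (-(2 * Real.pi * ħ / ς)) f).toLp 2 (volume : Measure (RSpace (ι ⊕ ι))) := by
    refine Lp.ext ((coeFn_weightedComp _ _ _ _ _ _).trans ?_)
    filter_upwards [f.coeFn_toLp 2 volume,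
      (chirpMul (-(2 * Real.pi * ħ / ς)) f).coeFn_toLp 2 volume] with s hs1 hs2
    rw [hs2, MeasurableEquiv.refl_apply, hs1, chirpMul_apply]
  have h2 : (Lp.fourierTransformₗᵢ (RSpace (ι ⊕ ι)) ℂ).symm
      ((chirpMul (-(2 * Real.pi * ħ / ς)) f).toLp 2 volume) =
      (𝓕⁻ (chirpMul (-(2 * Real.pi * ħ / ς)) f)).toLp 2 volume := SchwartzMap.toLp_fourierInv_eq _
  rw [phaseUnitary, LinearIsometryEquiv.trans_apply, LinearIsometryEquiv.trans_apply, h1, h2]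
  refine (coeFn_weightedComp _ _ _ _ _ _).trans ?_
  have hq : Measure.QuasiMeasurePreserving
      (frequencyEquiv hħ hς).toHomeomorph.toMeasurableEquiv (volume : Measure (Phase ι)) volume :=
    ⟨MeasurableEquiv.measurable _, by
      rw [map_frequencyEquiv hħ hς]; exact Measure.smul_absolutelyContinuous⟩
  filter_upwards [hq.ae ((𝓕⁻ (chirpMul (-(2 * Real.pi * ħ / ς)) f)).coeFn_toLp 2 volume)] with z hz
  rw [hz, phaseIntegral_eq hħ hς]
  rfl

theorem rapidDecay_phaseIntegral (hħ : 0 < ħ) (hς : 0 < ς) (f : 𝓢(RSpace (ι ⊕ ι), ℂ)) :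
    RapidDecay (phaseIntegral ħ ς f) := by
  refine ((𝓕⁻ (chirpMul (-(2 * Real.pi * ħ / ς)) f)).rapidDecay.comp_linearEquiv
    (frequencyEquiv hħ hς)).of_le _ (jacobianFactor_pos (Fintype.card ι) hħ hς).le 0 fun z => ?_
  rw [phaseIntegral_eq hħ hς, norm_mul, norm_phaseWeight hħ hς, pow_zero, mul_one]

theorem continuous_phaseIntegral (hħ : 0 < ħ) (hς : 0 < ς) (f : 𝓢(RSpace (ι ⊕ ι), ℂ)) :
    Continuous (phaseIntegral ħ ς f) := by
  have h : phaseIntegral ħ ς f = fun z => phaseWeight ħ ς z *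
      (𝓕⁻ (chirpMul (-(2 * Real.pi * ħ / ς)) f)) (frequencyEquiv hħ hς z) :=
    funext (phaseIntegral_eq hħ hς f)
  rw [h]
  exact continuous_phaseWeight.mul
    ((SchwartzMap.continuous _).comp (frequencyEquiv hħ hς).continuous)

end

section

variable {ι : Type*} [Fintype ι]

/-! ### The Weyl form of a point evaluation -/

variable {ħ ς : ℝ}

theorem norm_leftAction (ħ : ℝ) (z w : Phase ι) (F : Phase ι → ℂ) :
    ‖leftAction ħ z F w‖ = ‖F (w - z)‖ := by
  rw [leftAction, norm_mul, Complex.norm_exp]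
  simp

/-- The kernel `[Λ(2x - x₁, 2y - y₁) Φ](ς y₂, x₂ / ς)`, `z = (x, y)`, `p = ((x₁, x₂), (y₁, y₂))`. -/
def symbolKernel (ħ ς : ℝ) (Φ : Phase ι → ℂ) (z : Phase ι) (p : Phase (ι ⊕ ι)) : ℂ :=
  leftAction ħ ((2 : ℝ) • z - (part₁ p.1, part₁ p.2)) Φ (ς • part₂ p.2, ς⁻¹ • part₂ p.1)

theorem continuous_symbolKernel (ħ ς : ℝ) {Φ : Phase ι → ℂ} (hΦ : Continuous Φ) :
    Continuous fun q : Phase ι × Phase (ι ⊕ ι) => symbolKernel ħ ς Φ q.1 q.2 := by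
  have h1 := continuous_part₁ (ι := ι)
  have h2 := continuous_part₂ (ι := ι)
  unfold symbolKernel leftAction symplForm
  fun_prop

theorem continuous_symbolKernel_right (ħ ς : ℝ) {Φ : Phase ι → ℂ} (hΦ : Continuous Φ)
    (z : Phase ι) : Continuous (symbolKernel ħ ς Φ z) := by
  have h1 := continuous_part₁ (ι := ι)
  have h2 := continuous_part₂ (ι := ι)
  unfold symbolKernel leftAction symplForm
  fun_prop

/-- The Gaussian-type integral
`∫ Φ(Z) exp (π i ħ (Z₁·Z₂ - 2 Z₁·t₂ / ς + 2 Z₂·(x - t₁))) dZ`, `z = (x, y)`. -/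
def chirpTransform (ħ ς : ℝ) (Φ : Phase ι → ℂ) (z : Phase ι) (t : RSpace (ι ⊕ ι)) : ℂ :=
  ∫ Z : Phase ι, Φ Z * cexp ((Real.pi * ħ * (inner ℝ Z.1 Z.2 - 2 * ς⁻¹ * inner ℝ Z.1 (part₂ t) +
    2 * inner ℝ Z.2 (z.1 - part₁ t)) : ℝ) * I)

theorem continuous_chirpTransform (ħ ς : ℝ) {Φ : Phase ι → ℂ} (hΦ : Continuous Φ)
    (hΦi : Integrable Φ) (z : Phase ι) : Continuous (chirpTransform ħ ς Φ z) := by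
  have h1 := continuous_part₁ (ι := ι)
  have h2 := continuous_part₂ (ι := ι)
  refine continuous_of_dominated (bound := fun Z => ‖Φ Z‖) (fun t => ?_)
    (fun t => Filter.Eventually.of_forall fun Z => ?_) hΦi.norm
    (Filter.Eventually.of_forall fun Z => ?_)
  · exact Continuous.aestronglyMeasurable (by fun_prop)
  · rw [norm_mul, norm_exp_ofReal_mul_I, mul_one]
  · fun_prop

theorem norm_chirpTransform_le (ħ ς : ℝ) (Φ : Phase ι → ℂ) (z : Phase ι) (t : RSpace (ι ⊕ ι)) :
    ‖chirpTransform ħ ς Φ z t‖ ≤ ∫ Z, ‖Φ Z‖ := by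
  refine (norm_integral_le_integral_norm _).trans (le_of_eq ?_)
  congr 1
  ext Z
  rw [norm_mul, norm_exp_ofReal_mul_I, mul_one]

theorem integral_comp_joinEquiv_symm {F : Phase ι → ℂ} :
    ∫ Y, F ((joinEquiv ι).symm Y) = ∫ z, F z := by
  rw [← measurePreserving_joinEquiv.integral_comp
    (joinEquiv ι).toHomeomorph.measurableEmbedding]
  simp

theorem integral_comp_part (hς : 0 < ς) (H : Phase ι → ℂ) (a : Phase ι) :
    ∫ Y : RSpace (ι ⊕ ι), H ((ς • part₂ Y, part₁ Y) + a) =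
      ((ς ^ Fintype.card ι : ℝ) : ℂ)⁻¹ * ∫ Z, H Z := by
  have h1 := integral_comp_joinEquiv_symm (F := fun z => H (scaleSwap hς one_pos z + a))
  have h2 := integral_comp_scaleSwap hς one_pos (fun z : Phase ι => H (z + a))
  simp only [joinEquiv_symm_apply, scaleSwap_apply, one_smul] at h1
  rw [h1]
  simp only [scaleSwap_apply, one_smul, mul_one] at h2
  rw [h2, integral_add_right_eq_self]

/-- The crux. Taking the argument of `Φ` as the new variable `Z`, an affine change of `Y` with
Jacobian `ς^(-m)`, makes the total phase split into a part in `t`, `Z` and a part in `s` alone. The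
latter is the kernel of `V⁻¹`; the integral over `Z` is `chirpTransform`, independent of `s`. -/
theorem integral_symbolKernel (hς : 0 < ς) (Φ : Phase ι → ℂ) (z : Phase ι)
    (s t : RSpace (ι ⊕ ι)) :
    ∫ Y, symbolKernel ħ ς Φ z (t + s, Y) * cexp (Real.pi * I * ħ *
      ((-2 * inner ℝ Y t + inner ℝ (t + s) Y : ℝ) : ℂ)) =
    ((ς ^ Fintype.card ι : ℝ) : ℂ)⁻¹ *
      (conj (phaseKernel ħ ς z t) * chirpTransform ħ ς Φ z t * phaseKernel ħ ς z s) := by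
  have hςne := hς.ne'
  rw [chirpTransform, ← integral_const_mul, ← integral_mul_const, ← integral_comp_part hς _
    ((part₁ (t + s), ς⁻¹ • part₂ (t + s)) - (2 : ℝ) • z)]
  congr 1
  ext Y
  have hexp : ∀ a b c d e : ℂ, ∀ φ : ℂ, a + b = c + d + e →
      cexp a * φ * cexp b = cexp c * (φ * cexp d) * cexp e := by
    intro a b c d e φ h
    have : cexp a * cexp b = cexp c * cexp d * cexp e := by
      rw [← Complex.exp_add, ← Complex.exp_add, ← Complex.exp_add, h]
    linear_combination φ * this
  have harg : (ς • part₂ Y, ς⁻¹ • part₂ (t + s)) - ((2 : ℝ) • z - (part₁ (t + s), part₁ Y)) =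
      (ς • part₂ Y, part₁ Y) + ((part₁ (t + s), ς⁻¹ • part₂ (t + s)) - (2 : ℝ) • z) := by
    refine Prod.ext ?_ ?_
    · simp only [Prod.fst_sub, Prod.fst_add, Prod.smul_fst]
      abel
    · simp only [Prod.snd_sub, Prod.snd_add, Prod.smul_snd]
      abel
  rw [symbolKernel, leftAction, harg, phaseKernel, phaseKernel, ← Complex.exp_conj]
  refine hexp _ _ _ _ _ _ ?_
  -- The identity between the phases, with the common factor `πi` removed.
  have hreal : ħ * symplForm ((2 : ℝ) • z - (part₁ (t + s), part₁ Y))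
      (ς • part₂ Y, ς⁻¹ • part₂ (t + s)) + ħ * (-2 * inner ℝ Y t + inner ℝ (t + s) Y) =
      -(2 * ħ * (inner ℝ z.2 (part₁ t) + ς⁻¹ * inner ℝ z.1 (part₂ t) -
        ς⁻¹ * inner ℝ (part₁ t) (part₂ t))) +
      ħ * (inner ℝ ((ς • part₂ Y, part₁ Y) + ((part₁ (t + s), ς⁻¹ • part₂ (t + s)) - (2 : ℝ) • z)).1
        ((ς • part₂ Y, part₁ Y) + ((part₁ (t + s), ς⁻¹ • part₂ (t + s)) - (2 : ℝ) • z)).2 -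
        2 * ς⁻¹ * inner ℝ
          ((ς • part₂ Y, part₁ Y) + ((part₁ (t + s), ς⁻¹ • part₂ (t + s)) - (2 : ℝ) • z)).1
          (part₂ t) + 2 * inner ℝ
          ((ς • part₂ Y, part₁ Y) + ((part₁ (t + s), ς⁻¹ • part₂ (t + s)) - (2 : ℝ) • z)).2
          (z.1 - part₁ t)) +
      2 * ħ * (inner ℝ z.2 (part₁ s) + ς⁻¹ * inner ℝ z.1 (part₂ s) -
        ς⁻¹ * inner ℝ (part₁ s) (part₂ s)) := by
    simp only [symplForm, inner_eq_inner_part, part₁_add, part₂_add, Prod.fst_sub, Prod.fst_add,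
      Prod.smul_fst, Prod.snd_sub, Prod.snd_add, Prod.smul_snd, smul_add,
      inner_add_left, inner_add_right, inner_sub_left,
      inner_sub_right, real_inner_smul_left, real_inner_smul_right]
    generalize part₁ t = t₁
    generalize part₂ t = t₂
    generalize part₁ s = s₁
    generalize part₂ s = s₂
    generalize part₁ Y = y₁
    generalize part₂ Y = y₂
    rw [real_inner_comm z.1 t₂, real_inner_comm z.1 s₂, real_inner_comm t₁ t₂,
      real_inner_comm t₁ s₂, real_inner_comm z.1 z.2, real_inner_comm z.2 t₁,
      real_inner_comm z.2 s₁, real_inner_comm y₁ z.1, real_inner_comm y₂ t₂, real_inner_comm y₂ s₂]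
    field_simp
    ring
  have hc := congrArg (fun r : ℝ => (Real.pi : ℂ) * I * (r : ℂ)) hreal
  simp only [ofReal_add, ofReal_mul, ofReal_sub, ofReal_neg, map_mul, map_add, map_sub, conj_ofReal, conj_I] at hc ⊢
  linear_combination hc

theorem RapidDecay.comp_add_right {E F : Type*} [NormedAddCommGroup E] [NormedAddCommGroup F]
    {f : E → F} (hf : RapidDecay f) (a : E) : RapidDecay fun x => f (x + a) := by
  intro N
  obtain ⟨C, hC⟩ := hf N
  refine ⟨C * (1 + ‖a‖) ^ N, fun x => ?_⟩
  have h := one_add_norm_pow_le_mul x (x + a) N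
  rw [add_sub_cancel_left] at h
  calc ‖f (x + a)‖ * (1 + ‖x‖) ^ N ≤ ‖f (x + a)‖ * ((1 + ‖x + a‖) ^ N * (1 + ‖a‖) ^ N) := by gcongr
    _ = ‖f (x + a)‖ * (1 + ‖x + a‖) ^ N * (1 + ‖a‖) ^ N := by ring
    _ ≤ _ := by gcongr; exact hC _

theorem integral_convolution_mul {E : Type*} [NormedAddCommGroup E] [MeasurableSpace E]
    [BorelSpace E] [SecondCountableTopology E] {μ : Measure E} [SFinite μ] [μ.IsAddLeftInvariant]
    [μ.IsAddRightInvariant] {u v : E → ℂ} (hu : Integrable u μ) (hv : Integrable v μ) :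
    ∫ x, ∫ t, u t * v (x - t) ∂μ ∂μ = (∫ t, u t ∂μ) * ∫ s, v s ∂μ := by
  have h := integral_convolution (μ := μ) (ν := μ) (ContinuousLinearMap.mul ℝ ℂ) hu hv
  simpa [convolution] using h

theorem norm_symbolKernel (Φ : Phase ι → ℂ) (z : Phase ι) (p : Phase (ι ⊕ ι)) :
    ‖symbolKernel ħ ς Φ z p‖ = ‖Φ ((ς • part₂ p.2, part₁ p.2) +
      ((part₁ p.1, ς⁻¹ • part₂ p.1) - (2 : ℝ) • z))‖ := by
  rw [symbolKernel, norm_leftAction]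
  congr 2
  refine Prod.ext ?_ ?_
  · simp only [Prod.fst_sub, Prod.fst_add, Prod.smul_fst]
    abel
  · simp only [Prod.snd_sub, Prod.snd_add, Prod.smul_snd]
    abel

theorem integrable_symbolKernel_slice (hς : 0 < ς) {Φ : Phase ι → ℂ}
    (hΦ : Continuous Φ) (hΦd : RapidDecay Φ) (z : Phase ι) (X : RSpace (ι ⊕ ι)) :
    Integrable fun Y => symbolKernel ħ ς Φ z (X, Y) := by
  set a : Phase ι := (part₁ X, ς⁻¹ • part₂ X) - (2 : ℝ) • z with ha
  have hd := RapidDecay.comp_linearEquiv (hΦd.comp_add_right a)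
    ((joinEquiv ι).symm.trans (scaleSwap hς one_pos))
  have hc : Continuous fun Y : RSpace (ι ⊕ ι) => Φ (((joinEquiv ι).symm.trans
      (scaleSwap hς one_pos)) Y + a) :=
    hΦ.comp ((ContinuousLinearEquiv.continuous _).add continuous_const)
  have hi := hd.integrable (μ := volume) hc.aestronglyMeasurable
  refine hi.norm.mono' ((continuous_symbolKernel_right ħ ς hΦ z).comp
    (Continuous.prodMk_right X)).aestronglyMeasurable
    (Filter.Eventually.of_forall fun Y => ?_)
  rw [norm_symbolKernel]
  refine le_of_eq (congrArg (fun w => ‖Φ (w + a)‖) ?_)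
  exact Prod.ext rfl (one_smul ℝ (part₁ Y)).symm

/-- The reflection makes the window appear as `f (X - t)`, so the integrand has the shape of a
convolution in `X`. -/
theorem conj_fourierWigner_neg (f g : RSpace ι → ℂ) (X Y : RSpace ι) :
    conj (fourierWigner ħ g (fun t => f (-t)) (X, Y)) =
      ∫ t, conj (g t) * f (X - t) *
        cexp (Real.pi * I * ħ * ((-2 * inner ℝ Y t + inner ℝ X Y : ℝ) : ℂ)) := by
  rw [fourierWigner, ← integral_conj]
  congr 1
  ext t
  rw [map_mul, Complex.conj_conj, schrodingerRep, neg_sub]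
  ring

theorem norm_cexp_pi_mul_I (ħ r : ℝ) : ‖cexp (Real.pi * I * ħ * (r : ℂ))‖ = 1 := by
  rw [Complex.norm_exp]
  simp

theorem integrable_conj_mul_comp_sub (f g : 𝓢(RSpace ι, ℂ)) (X : RSpace ι) :
    Integrable fun t => conj (g t) * f (X - t) := by
  obtain ⟨C, hC⟩ := f.rapidDecay.bounded
  have hfc := f.continuous
  have hgc := g.continuous
  refine (g.integrable.norm.mul_const C).mono'
    (Continuous.aestronglyMeasurable (by fun_prop)) (Filter.Eventually.of_forall fun t => ?_)
  rw [norm_mul, RCLike.norm_conj]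
  gcongr
  exact hC _

/-- Integrating over `Y` before `t` brings in `integral_symbolKernel` with `s = X - t`; what remains
is a convolution evaluated at `X`. -/
theorem integral_symbolKernel_slice (hς : 0 < ς) {Φ : Phase ι → ℂ}
    (hΦ : Continuous Φ) (hΦd : RapidDecay Φ) (z : Phase ι) (f g : 𝓢(RSpace (ι ⊕ ι), ℂ))
    (X : RSpace (ι ⊕ ι)) :
    ∫ Y, symbolKernel ħ ς Φ z (X, Y) * conj (fourierWigner ħ g (fun t => f (-t)) (X, Y)) =
      ((ς ^ Fintype.card ι : ℝ) : ℂ)⁻¹ * ∫ t, conj (g t * phaseKernel ħ ς z t) *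
        chirpTransform ħ ς Φ z t * (f (X - t) * phaseKernel ħ ς z (X - t)) := by
  have hfc := f.continuous
  have hgc := g.continuous
  have hKc : Continuous fun Y => symbolKernel ħ ς Φ z (X, Y) :=
    (continuous_symbolKernel_right ħ ς hΦ z).comp (Continuous.prodMk_right X)
  have hprod : Integrable (Function.uncurry fun (Y t : RSpace (ι ⊕ ι)) =>
      symbolKernel ħ ς Φ z (X, Y) * (conj (g t) * f (X - t) *
      cexp (Real.pi * I * ħ * ((-2 * inner ℝ Y t + inner ℝ X Y : ℝ) : ℂ))))
      (volume.prod volume) := by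
    have hi := ((integrable_symbolKernel_slice (ħ := ħ) hς hΦ hΦd z X).mul_prod
      (integrable_conj_mul_comp_sub f g X)).norm
    refine hi.mono' (Continuous.aestronglyMeasurable ?_) (Filter.Eventually.of_forall fun q => ?_)
    · refine (hKc.comp continuous_fst).mul ?_
      fun_prop
    · simp only [Function.uncurry, norm_mul, norm_cexp_pi_mul_I, mul_one]
      exact le_rfl
  simp only [conj_fourierWigner_neg, ← integral_const_mul]
  rw [integral_integral_swap hprod]
  congr 1
  ext t
  have h := integral_symbolKernel (ħ := ħ) hς Φ z (X - t) t
  rw [add_sub_cancel] at h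
  simp only [mul_left_comm (symbolKernel ħ ς Φ z _)]
  rw [integral_const_mul, h, map_mul]
  ring

theorem integrable_mul_phaseKernel (f : 𝓢(RSpace (ι ⊕ ι), ℂ)) (z : Phase ι) :
    Integrable fun s => f s * phaseKernel ħ ς z s := by
  refine f.integrable.norm.mono' (f.continuous.mul (continuous_phaseKernel_right ħ ς z)).aestronglyMeasurable
    (Filter.Eventually.of_forall fun t => ?_)
  rw [norm_mul, norm_phaseKernel, mul_one]

theorem integrable_conj_mul_chirpTransform {Φ : Phase ι → ℂ} (hΦ : Continuous Φ)
    (hΦi : Integrable Φ) (z : Phase ι) (g : 𝓢(RSpace (ι ⊕ ι), ℂ)) :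
    Integrable fun t => conj (g t * phaseKernel ħ ς z t) * chirpTransform ħ ς Φ z t := by
  have hi := integrable_mul_phaseKernel (ħ := ħ) (ς := ς) g z
  refine (hi.norm.mul_const (∫ Z, ‖Φ Z‖)).mono' ((continuous_conj.comp_aestronglyMeasurable
    hi.1).mul (continuous_chirpTransform ħ ς hΦ hΦi z).aestronglyMeasurable)
    (Filter.Eventually.of_forall fun t => ?_)
  rw [norm_mul, RCLike.norm_conj]
  gcongr
  exact norm_chirpTransform_le ħ ς Φ z t

theorem integrable_symbolKernel_mul_fourierWigner (hħ : 0 < ħ) {Φ : Phase ι → ℂ}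
    (hΦ : Continuous Φ) (hΦd : RapidDecay Φ) (z : Phase ι) (f g : 𝓢(RSpace (ι ⊕ ι), ℂ)) :
    Integrable fun p => symbolKernel ħ ς Φ z p *
      conj (fourierWigner ħ g (fun t => f (-t)) p) := by
  obtain ⟨C, hC⟩ := hΦd.bounded
  have hfn : RapidFourier fun t => f (-t) := f.rapidFourier.comp_neg
  have hW := integrable_fourierWigner hħ g.rapidFourier hfn
  have hKc := continuous_symbolKernel_right ħ ς hΦ z
  refine (hW.norm.const_mul C).mono' (hKc.mul (continuous_conj.comp
    (continuous_fourierWigner ħ g.rapidFourier hfn))).aestronglyMeasurable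
    (Filter.Eventually.of_forall fun p => ?_)
  rw [norm_mul, RCLike.norm_conj, norm_symbolKernel]
  gcongr
  exact hC _

/-- The integral over `X` of a convolution is a product of integrals: the Weyl form of `K_z` has
rank one. -/
theorem integral_symbolKernel_mul_fourierWigner (hħ : 0 < ħ) (hς : 0 < ς) {Φ : Phase ι → ℂ}
    (hΦ : Continuous Φ) (hΦd : RapidDecay Φ) (z : Phase ι) (f g : 𝓢(RSpace (ι ⊕ ι), ℂ)) :
    ∫ p, symbolKernel ħ ς Φ z p * conj (fourierWigner ħ g (fun t => f (-t)) p) =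
      ((ς ^ Fintype.card ι : ℝ) : ℂ)⁻¹ *
        ((∫ t, conj (g t * phaseKernel ħ ς z t) * chirpTransform ħ ς Φ z t) *
          ∫ s, f s * phaseKernel ħ ς z s) := by
  have hint := integrable_symbolKernel_mul_fourierWigner (ς := ς) hħ hΦ hΦd z f g
  rw [Measure.volume_eq_prod] at hint ⊢
  rw [integral_prod _ hint]
  simp only [integral_symbolKernel_slice hς hΦ hΦd z f g]
  rw [integral_const_mul]
  congr 1
  exact integral_convolution_mul (integrable_conj_mul_chirpTransform hΦ
    (hΦd.integrable hΦ.aestronglyMeasurable) z g) (integrable_mul_phaseKernel f z)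

/-! ### The other side: the reproducing kernel applied to `V⁻¹ g` -/

/-- With `w = Z + z` the phases of the reproducing kernel and of `V⁻¹` combine into exactly the
phase of `chirpTransform`. The prefactor is `conj (phaseWeight ħ ς z)`, written so that it meets
`phaseWeight_mul_self`. -/
theorem conj_phaseIntegral_mul_leftAction (Φ : Phase ι → ℂ) (z Z : Phase ι)
    (t : RSpace (ι ⊕ ι)) :
    conj (phaseWeight ħ ς (Z + z) * phaseKernel ħ ς (Z + z) t) * leftAction ħ z Φ (Z + z) =
      phaseWeight ħ ς z *
        cexp ((2 * Real.pi * ħ * inner ℝ z.1 z.2 : ℝ) * I) *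
      (conj (phaseKernel ħ ς z t) * (Φ Z * cexp ((Real.pi * ħ * (inner ℝ Z.1 Z.2 -
        2 * ς⁻¹ * inner ℝ Z.1 (part₂ t) + 2 * inner ℝ Z.2 (z.1 - part₁ t)) : ℝ) * I))) := by
  have hexp : ∀ (J φ a b c d e f g : ℂ), a + b + c = d + e + f + g →
      J * cexp a * cexp b * (cexp c * φ) =
        J * cexp d * cexp e * (cexp f * (φ * cexp g)) := by
    intro J φ a b c d e f g h
    have : cexp a * cexp b * cexp c = cexp d * cexp e * cexp f * cexp g := by
      rw [← Complex.exp_add, ← Complex.exp_add, ← Complex.exp_add, ← Complex.exp_add,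
        ← Complex.exp_add, h]
    linear_combination J * φ * this
  rw [leftAction, add_sub_cancel_right, phaseWeight, phaseWeight, phaseKernel, phaseKernel,
    map_mul, map_mul, conj_ofReal, ← Complex.exp_conj, ← Complex.exp_conj, ← Complex.exp_conj]
  refine hexp _ _ _ _ _ _ _ _ _ ?_
  have hreal : Real.pi * ħ * inner ℝ (Z + z).1 (Z + z).2 -
      2 * Real.pi * ħ * (inner ℝ (Z + z).2 (part₁ t) + ς⁻¹ * inner ℝ (Z + z).1 (part₂ t) -
        ς⁻¹ * inner ℝ (part₁ t) (part₂ t)) + Real.pi * ħ * symplForm z (Z + z) =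
      -(Real.pi * ħ * inner ℝ z.1 z.2) + 2 * Real.pi * ħ * inner ℝ z.1 z.2 -
      2 * Real.pi * ħ * (inner ℝ z.2 (part₁ t) + ς⁻¹ * inner ℝ z.1 (part₂ t) -
        ς⁻¹ * inner ℝ (part₁ t) (part₂ t)) + Real.pi * ħ * (inner ℝ Z.1 Z.2 -
        2 * ς⁻¹ * inner ℝ Z.1 (part₂ t) + 2 * inner ℝ Z.2 (z.1 - part₁ t)) := by
    simp only [symplForm, Prod.fst_add, Prod.snd_add, inner_add_left, inner_add_right,
      inner_sub_right]
    rw [real_inner_comm z.1 Z.2]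
    ring
  have hc := congrArg (fun r : ℝ => (r : ℂ) * I) hreal
  simp only [map_mul, conj_ofReal, conj_I]
  push_cast at hc ⊢
  linear_combination hc

theorem integral_conj_phaseIntegral_mul_leftAction {Φ : Phase ι → ℂ}
    (hΦ : Continuous Φ) (hΦi : Integrable Φ) (z : Phase ι) (g : 𝓢(RSpace (ι ⊕ ι), ℂ)) :
    ∫ w, conj (phaseIntegral ħ ς g w) * leftAction ħ z Φ w =
      phaseWeight ħ ς z * cexp ((2 * Real.pi * ħ * inner ℝ z.1 z.2 : ℝ) * I) *
        ∫ t, conj (g t * phaseKernel ħ ς z t) * chirpTransform ħ ς Φ z t := by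
  rw [← integral_add_right_eq_self _ z]
  have h1 : ∀ Z : Phase ι, conj (phaseIntegral ħ ς g (Z + z)) * leftAction ħ z Φ (Z + z) =
      ∫ t, phaseWeight ħ ς z * cexp ((2 * Real.pi * ħ * inner ℝ z.1 z.2 : ℝ) * I) *
        (conj (g t * phaseKernel ħ ς z t) * (Φ Z * cexp ((Real.pi * ħ * (inner ℝ Z.1 Z.2 -
        2 * ς⁻¹ * inner ℝ Z.1 (part₂ t) + 2 * inner ℝ Z.2 (z.1 - part₁ t)) : ℝ) * I))) := by
    intro Z
    rw [phaseIntegral, map_mul, ← integral_conj, mul_right_comm, ← integral_const_mul]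
    congr 1
    ext t
    have h := conj_phaseIntegral_mul_leftAction (ħ := ħ) (ς := ς) Φ z Z t
    rw [map_mul] at h ⊢
    rw [map_mul]
    linear_combination conj (g t) * h
  simp only [h1]
  have hp1 := continuous_part₁ (ι := ι)
  have hp2 := continuous_part₂ (ι := ι)
  have hgi := integrable_mul_phaseKernel (ħ := ħ) (ς := ς) g z
  have hgc : Continuous fun t => g t * phaseKernel ħ ς z t :=
    g.continuous.mul (continuous_phaseKernel_right ħ ς z)
  have hint : Integrable (Function.uncurry fun (Z : Phase ι) (t : RSpace (ι ⊕ ι)) =>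
      phaseWeight ħ ς z * cexp ((2 * Real.pi * ħ * inner ℝ z.1 z.2 : ℝ) * I) *
        (conj (g t * phaseKernel ħ ς z t) * (Φ Z * cexp ((Real.pi * ħ * (inner ℝ Z.1 Z.2 -
        2 * ς⁻¹ * inner ℝ Z.1 (part₂ t) + 2 * inner ℝ Z.2 (z.1 - part₁ t)) : ℝ) * I))))
      (volume.prod volume) := by
    refine Integrable.const_mul ?_ _
    refine (hΦi.mul_prod hgi).norm.mono' (Continuous.aestronglyMeasurable ?_)
      (Filter.Eventually.of_forall fun q => ?_)
    · refine (continuous_conj.comp (hgc.comp continuous_snd)).mul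
        ((hΦ.comp continuous_fst).mul ?_)
      fun_prop
    · rw [norm_mul, norm_mul (Φ q.1), norm_exp_ofReal_mul_I, RCLike.norm_conj, mul_one, mul_comm,
        ← norm_mul]
  rw [integral_integral_swap hint, ← integral_const_mul]
  congr 1
  ext t
  rw [integral_const_mul, integral_const_mul, chirpTransform]

theorem phaseWeight_mul_self (hħ : 0 < ħ) (hς : 0 < ς) (z : Phase ι) :
    phaseWeight ħ ς z * phaseWeight ħ ς z *
      cexp ((2 * Real.pi * ħ * inner ℝ z.1 z.2 : ℝ) * I) =
      (((ħ * (ħ / ς)) ^ Fintype.card ι : ℝ) : ℂ) := by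
  have h : cexp ((-(Real.pi * ħ * inner ℝ z.1 z.2) : ℝ) * I) *
      cexp ((-(Real.pi * ħ * inner ℝ z.1 z.2) : ℝ) * I) *
      cexp ((2 * Real.pi * ħ * inner ℝ z.1 z.2 : ℝ) * I) = 1 := by
    rw [← Complex.exp_add, ← Complex.exp_add, ← Complex.exp_zero]
    congr 1
    push_cast
    ring
  rw [← jacobianFactor_sq _ hħ hς, phaseWeight]
  push_cast at h ⊢
  linear_combination (jacobianFactor (Fintype.card ι) ħ ς : ℂ) ^ 2 * h

/-- Both sides contain the same two integrals, over `t` and over `s`. The constants agree because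
the squared modulus of the weight is `(ħ²/ς)^m`, that is `ħ^(2m)` times the Jacobian `ς^(-m)`. -/
theorem integral_symbolKernel_mul_conj_fourierWigner (hħ : 0 < ħ) (hς : 0 < ς) {Φ : Phase ι → ℂ}
    (hΦ : Continuous Φ) (hΦd : RapidDecay Φ) (z : Phase ι) (f g : 𝓢(RSpace (ι ⊕ ι), ℂ)) :
    ((ħ ^ (2 * Fintype.card ι) : ℝ) : ℂ) *
      ∫ p, symbolKernel ħ ς Φ z p * conj (fourierWigner ħ g (fun t => f (-t)) p) =
      phaseIntegral ħ ς f z * ∫ w, conj (phaseIntegral ħ ς g w) * leftAction ħ z Φ w := by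
  rw [integral_symbolKernel_mul_fourierWigner hħ hς hΦ hΦd,
    integral_conj_phaseIntegral_mul_leftAction hΦ
      (hΦd.integrable hΦ.aestronglyMeasurable), phaseIntegral]
  have h := phaseWeight_mul_self hħ hς z
  have h2 : ((ħ ^ (2 * Fintype.card ι) : ℝ) : ℂ) * ((ς ^ Fintype.card ι : ℝ) : ℂ)⁻¹ =
      (((ħ * (ħ / ς)) ^ Fintype.card ι : ℝ) : ℂ) := by
    rw [← ofReal_inv, ← ofReal_mul]
    congr 1
    rw [pow_mul, ← inv_pow, ← mul_pow]
    congr 1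
    field_simp
  rw [← mul_assoc, h2, ← h]
  ring

end

section

variable {ι : Type*} [Fintype ι]

/-! ### Integrability of the symbol -/

variable {ħ τ ς : ℝ}

theorem continuous_mixedGaussian (hħ : 0 < ħ) (hτ : 0 < τ) (hς : 0 < ς) :
    Continuous (mixedGaussian (ι := ι) ħ τ ς) :=
  continuous_fourierWigner ħ (rapidFourier_squeezedGaussian hħ hς)
    (rapidFourier_squeezedGaussian hħ hτ)

theorem rapidDecay_mixedGaussian (hħ : 0 < ħ) (hτ : 0 < τ) (hς : 0 < ς) :
    RapidDecay (mixedGaussian (ι := ι) ħ τ ς) :=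
  rapidDecay_fourierWigner hħ (rapidFourier_squeezedGaussian hħ hς)
    (rapidFourier_squeezedGaussian hħ hτ)

theorem integral_comp_smul_sub {E : Type*} [NormedAddCommGroup E] [NormedSpace ℝ E]
    [FiniteDimensional ℝ E] [MeasurableSpace E] [BorelSpace E] {μ : Measure E}
    [μ.IsAddHaarMeasure] (H : E → ℝ) (a : E) :
    ∫ z, H (a - (2 : ℝ) • z) ∂μ = |((2 : ℝ) ^ Module.finrank ℝ E)⁻¹| * ∫ z, H z ∂μ := by
  rw [Measure.integral_comp_smul μ (fun w => H (a - w)) 2, smul_eq_mul,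
    integral_sub_left_eq_self H μ a]

theorem integrable_comp_smul_sub {E : Type*} [NormedAddCommGroup E] [NormedSpace ℝ E]
    [FiniteDimensional ℝ E] [MeasurableSpace E] [BorelSpace E] {μ : Measure E}
    [μ.IsAddHaarMeasure] {H : E → ℝ} (hH : Integrable H μ) (a : E) :
    Integrable (fun z => H (a - (2 : ℝ) • z)) μ :=
  (integrable_comp_smul_iff μ (fun w => H (a - w)) two_ne_zero).2 (hH.comp_sub_left a)

/-- An integrable majorant for a function of moderate growth times a dilated translate of a rapidly
decaying function, with moderate growth in the translation. -/
theorem integrable_mul_comp_smul_sub {E : Type*} [NormedAddCommGroup E] [NormedSpace ℝ E]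
    [FiniteDimensional ℝ E] [MeasurableSpace E] [BorelSpace E] {μ : Measure E}
    [μ.IsAddHaarMeasure] {Φ ψ : E → ℂ} (hΦ : Continuous Φ) (hΦd : RapidDecay Φ) {N : ℕ}
    (hψ : MemLp (fun z => ψ z / (((1 + ‖z‖) ^ N : ℝ) : ℂ)) 2 μ) :
    (∀ a : E, Integrable (fun z => ‖ψ z‖ * ‖Φ (a - (2 : ℝ) • z)‖) μ) ∧
    ∃ C : ℝ, 0 ≤ C ∧ ∀ a : E,
      ∫ z, ‖ψ z‖ * ‖Φ (a - (2 : ℝ) • z)‖ ∂μ ≤ C * (1 + ‖a‖) ^ (2 * N) := by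
  set ψ₀ : E → ℂ := fun z => ψ z / (((1 + ‖z‖) ^ N : ℝ) : ℂ) with hψ₀
  set H : E → ℝ := fun w => (1 + ‖w‖) ^ (2 * N) * ‖Φ w‖ ^ 2 with hH
  have hψ2 : Integrable (fun z => ‖ψ₀ z‖ ^ 2) μ := (memLp_two_iff_integrable_sq_norm hψ.1).1 hψ
  obtain ⟨CΦ, hCΦ⟩ := hΦd.bounded
  have hHi : Integrable H μ := by
    have hd : RapidDecay H := hΦd.of_le |CΦ| (abs_nonneg _) (2 * N) fun w => by
      rw [Real.norm_of_nonneg (by positivity)]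
      change (1 + ‖w‖) ^ (2 * N) * ‖Φ w‖ ^ 2 ≤ _
      rw [sq, mul_comm |CΦ|, mul_assoc]
      gcongr
      exact (hCΦ w).trans (le_abs_self _)
    exact hd.integrable (Continuous.aestronglyMeasurable (by fun_prop))
  have hψeq : ∀ z, ‖ψ z‖ = ‖ψ₀ z‖ * (1 + ‖z‖) ^ N := fun z => by
    rw [hψ₀, norm_div, norm_real, Real.norm_of_nonneg (by positivity),
      div_mul_cancel₀ _ (by positivity)]
  -- Since `1 + ‖z‖ ≤ (1 + ‖a‖)(1 + ‖a - 2z‖)`, the weight removed from `ψ` is absorbed by `Φ` at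
  -- the price of growth in `a`. Then `AB ≤ A² + B²` separates the factors; the squaring is the
  -- source of the exponent `2 * N`.
  have hle : ∀ a z, ‖ψ z‖ * ‖Φ (a - (2 : ℝ) • z)‖ ≤
      ‖ψ₀ z‖ ^ 2 + (1 + ‖a‖) ^ (2 * N) * H (a - (2 : ℝ) • z) := fun a z => by
    have h1 : 1 + ‖z‖ ≤ (1 + ‖a‖) * (1 + ‖a - (2 : ℝ) • z‖) := by
      have h2 : ‖(2 : ℝ) • z‖ ≤ ‖a‖ + ‖a - (2 : ℝ) • z‖ := by
        have := norm_sub_le a (a - (2 : ℝ) • z)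
        rwa [sub_sub_cancel] at this
      rw [norm_smul, Real.norm_ofNat] at h2
      nlinarith [norm_nonneg z, norm_nonneg a, norm_nonneg (a - (2 : ℝ) • z)]
    calc _ = ‖ψ₀ z‖ * ((1 + ‖z‖) ^ N * ‖Φ (a - (2 : ℝ) • z)‖) := by rw [hψeq]; ring
      _ ≤ ‖ψ₀ z‖ * (((1 + ‖a‖) * (1 + ‖a - (2 : ℝ) • z‖)) ^ N * ‖Φ (a - (2 : ℝ) • z)‖) := by gcongr
      _ ≤ ‖ψ₀ z‖ ^ 2 +
          (((1 + ‖a‖) * (1 + ‖a - (2 : ℝ) • z‖)) ^ N * ‖Φ (a - (2 : ℝ) • z)‖) ^ 2 := by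
        nlinarith [sq_nonneg (‖ψ₀ z‖ -
          ((1 + ‖a‖) * (1 + ‖a - (2 : ℝ) • z‖)) ^ N * ‖Φ (a - (2 : ℝ) • z)‖),
          sq_nonneg ‖ψ₀ z‖, sq_nonneg
          (((1 + ‖a‖) * (1 + ‖a - (2 : ℝ) • z‖)) ^ N * ‖Φ (a - (2 : ℝ) • z)‖)]
      _ = _ := by
        rw [hH, mul_pow _ (‖Φ _‖), ← pow_mul, mul_comm N, mul_pow, mul_assoc]
  have hmaj : ∀ a, Integrable (fun z => ‖ψ₀ z‖ ^ 2 +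
      (1 + ‖a‖) ^ (2 * N) * H (a - (2 : ℝ) • z)) μ := fun a =>
    hψ2.add ((integrable_comp_smul_sub hHi a).const_mul _)
  have hψm : AEStronglyMeasurable (fun z => ‖ψ z‖) μ := by
    simp only [hψeq]
    exact hψ.1.norm.mul (Continuous.aestronglyMeasurable (by fun_prop))
  refine ⟨fun a => (hmaj a).mono' (hψm.mul (Continuous.aestronglyMeasurable (by fun_prop)))
    (Filter.Eventually.of_forall fun z => ?_), (∫ z, ‖ψ₀ z‖ ^ 2 ∂μ) +
      |((2 : ℝ) ^ Module.finrank ℝ E)⁻¹| * ∫ z, H z ∂μ, ?_, fun a => ?_⟩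
  · rw [Real.norm_of_nonneg (by positivity)]
    exact hle a z
  · have : 0 ≤ ∫ z, H z ∂μ := integral_nonneg fun z => by positivity
    have : 0 ≤ ∫ z, ‖ψ₀ z‖ ^ 2 ∂μ := integral_nonneg fun z => by positivity
    positivity
  · have h1 : ∫ z, ‖ψ z‖ * ‖Φ (a - (2 : ℝ) • z)‖ ∂μ ≤ ∫ z, (‖ψ₀ z‖ ^ 2 +
      (1 + ‖a‖) ^ (2 * N) * H (a - (2 : ℝ) • z)) ∂μ :=
      integral_mono_of_nonneg (Filter.Eventually.of_forall fun z => by positivity) (hmaj a)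
        (Filter.Eventually.of_forall (hle a))
    rw [integral_add hψ2 ((integrable_comp_smul_sub hHi a).const_mul _), integral_const_mul,
      integral_comp_smul_sub H a] at h1
    have h2 : 0 ≤ ∫ z, ‖ψ₀ z‖ ^ 2 ∂μ := integral_nonneg fun z => by positivity
    have h3 : (1 : ℝ) ≤ (1 + ‖a‖) ^ (2 * N) := one_le_pow₀ (by linarith [norm_nonneg a])
    nlinarith

theorem aestronglyMeasurable_of_div {E : Type*} [NormedAddCommGroup E] [MeasurableSpace E]
    [BorelSpace E] {μ : Measure E} {ψ : E → ℂ} {N : ℕ}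
    (hψ : AEStronglyMeasurable (fun z => ψ z / (((1 + ‖z‖) ^ N : ℝ) : ℂ)) μ) :
    AEStronglyMeasurable ψ μ := by
  have hc : Continuous fun z : E => (((1 + ‖z‖) ^ N : ℝ) : ℂ) := by fun_prop
  refine (hψ.mul hc.aestronglyMeasurable).congr (Filter.Eventually.of_forall fun z => ?_)
  refine div_mul_cancel₀ _ ?_
  have : (0 : ℝ) < (1 + ‖z‖) ^ N := by positivity
  exact_mod_cast this.ne'

/-- The linear map `((x₁, x₂), (y₁, y₂)) ↦ (ς y₂ + x₁, y₁ + x₂ / ς)`. -/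
def symbolShift (ς : ℝ) (p : Phase (ι ⊕ ι)) : Phase ι :=
  (ς • part₂ p.2, part₁ p.2) + (part₁ p.1, ς⁻¹ • part₂ p.1)

theorem norm_symbolShift_le (ς : ℝ) :
    ∃ K : ℝ, 0 ≤ K ∧ ∀ p : Phase (ι ⊕ ι), ‖symbolShift ς p‖ ≤ K * ‖p‖ := by
  set J : ℝ := ‖((joinEquiv ι).symm : RSpace (ι ⊕ ι) →L[ℝ] Phase ι)‖ with hJ
  have hb : ∀ s : RSpace (ι ⊕ ι), ‖part₁ s‖ ≤ J * ‖s‖ ∧ ‖part₂ s‖ ≤ J * ‖s‖ := fun s => by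
    have h := ((joinEquiv ι).symm : RSpace (ι ⊕ ι) →L[ℝ] Phase ι).le_opNorm s
    exact ⟨(norm_fst_le (part₁ s, part₂ s)).trans h, (norm_snd_le (part₁ s, part₂ s)).trans h⟩
  have hJ0 : 0 ≤ J := norm_nonneg _
  refine ⟨(|ς| + 1 + |ς⁻¹|) * J, by positivity, fun p => ?_⟩
  obtain ⟨h1, h2⟩ := hb p.1
  obtain ⟨h3, h4⟩ := hb p.2
  have h5 : J * ‖p.1‖ ≤ J * ‖p‖ := mul_le_mul_of_nonneg_left (norm_fst_le p) hJ0
  have h6 : J * ‖p.2‖ ≤ J * ‖p‖ := mul_le_mul_of_nonneg_left (norm_snd_le p) hJ0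
  have h7 : 0 ≤ J * ‖p‖ := by positivity
  refine max_le ?_ ?_
  · refine (norm_add_le _ _).trans ?_
    simp only [norm_smul, Real.norm_eq_abs]
    nlinarith [mul_le_mul_of_nonneg_left (h4.trans h6) (abs_nonneg ς), h1.trans h5,
      mul_nonneg (abs_nonneg ς⁻¹) h7]
  · refine (norm_add_le _ _).trans ?_
    simp only [norm_smul, Real.norm_eq_abs]
    nlinarith [mul_le_mul_of_nonneg_left (h2.trans h5) (abs_nonneg ς⁻¹), h3.trans h6,
      mul_nonneg (abs_nonneg ς) h7]

theorem norm_symbolKernel_eq (Φ : Phase ι → ℂ) (z : Phase ι) (p : Phase (ι ⊕ ι)) :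
    ‖symbolKernel ħ ς Φ z p‖ = ‖Φ (symbolShift ς p - (2 : ℝ) • z)‖ := by
  rw [norm_symbolKernel, symbolShift, add_sub_assoc]

theorem continuous_symbolKernel_left (ħ ς : ℝ) {Φ : Phase ι → ℂ} (hΦ : Continuous Φ)
    (p : Phase (ι ⊕ ι)) : Continuous fun z => symbolKernel ħ ς Φ z p := by
  unfold symbolKernel leftAction symplForm
  fun_prop

theorem integrable_mul_symbolKernel {Φ ψ : Phase ι → ℂ} (hΦ : Continuous Φ)
    (hΦd : RapidDecay Φ) {N : ℕ}
    (hψ : MemLp (fun z => ψ z / (((1 + ‖z‖) ^ N : ℝ) : ℂ)) 2 volume) (p : Phase (ι ⊕ ι)) :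
    Integrable fun z => ψ z * symbolKernel ħ ς Φ z p := by
  refine ((integrable_mul_comp_smul_sub hΦ hΦd hψ).1 (symbolShift ς p)).mono'
    ((aestronglyMeasurable_of_div hψ.1).mul
      (continuous_symbolKernel_left ħ ς hΦ p).aestronglyMeasurable)
    (Filter.Eventually.of_forall fun z => ?_)
  rw [norm_mul, norm_symbolKernel_eq]

/-- Licence for Fubini between `z` and `p`: the integral over `z` of the norms grows at most
polynomially in `p`, through the linear shift of the argument of `Φ`, and `Q` absorbs that growth.
-/
theorem integrable_prod_mul_symbolKernel {Φ ψ : Phase ι → ℂ} (hΦ : Continuous Φ)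
    (hΦd : RapidDecay Φ) {N : ℕ}
    (hψ : MemLp (fun z => ψ z / (((1 + ‖z‖) ^ N : ℝ) : ℂ)) 2 volume) {Q : Phase (ι ⊕ ι) → ℂ}
    (hQ : Continuous Q) (hQd : RapidDecay Q) :
    Integrable (fun q : Phase ι × Phase (ι ⊕ ι) => ψ q.1 * symbolKernel ħ ς Φ q.1 q.2 * Q q.2)
      (volume.prod volume) := by
  have hm : AEStronglyMeasurable (fun q : Phase ι × Phase (ι ⊕ ι) =>
      ψ q.1 * symbolKernel ħ ς Φ q.1 q.2 * Q q.2) (volume.prod volume) :=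
    ((aestronglyMeasurable_of_div hψ.1).comp_fst.mul
      (continuous_symbolKernel ħ ς hΦ).aestronglyMeasurable).mul
      (hQ.comp continuous_snd).aestronglyMeasurable
  refine (integrable_prod_iff' hm).2 ⟨Filter.Eventually.of_forall fun p =>
    (integrable_mul_symbolKernel hΦ hΦd hψ p).mul_const (Q p), ?_⟩
  obtain ⟨C, hC, hCle⟩ := (integrable_mul_comp_smul_sub hΦ hΦd hψ).2
  obtain ⟨K, hK, hKle⟩ := norm_symbolShift_le (ι := ι) ς
  have hmaj : Integrable fun p : Phase (ι ⊕ ι) => C * ((1 + K) ^ (2 * N) *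
      (1 + ‖p‖) ^ (2 * N)) * ‖Q p‖ := by
    have hd : RapidDecay fun p : Phase (ι ⊕ ι) => C * ((1 + K) ^ (2 * N) *
      (1 + ‖p‖) ^ (2 * N)) * ‖Q p‖ :=
      hQd.of_le (C * (1 + K) ^ (2 * N)) (by positivity) (2 * N) fun p => by
        rw [Real.norm_of_nonneg (by positivity), ← mul_assoc C]
    exact hd.integrable (Continuous.aestronglyMeasurable (by fun_prop))
  refine hmaj.mono' hm.norm.prod_swap.integral_prod_right' (Filter.Eventually.of_forall fun p => ?_)
  rw [Real.norm_of_nonneg (integral_nonneg fun z => norm_nonneg _)]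
  simp only [norm_mul, norm_symbolKernel_eq]
  rw [integral_mul_const]
  gcongr
  refine (hCle _).trans ?_
  rw [← mul_pow]
  gcongr
  nlinarith [hKle p, norm_nonneg p]

/-! ### The Weyl form of the symbol -/

theorem crossIntegrand_eq (ψ : Phase ι → ℂ) (p : Phase (ι ⊕ ι)) :
    crossIntegrand ħ τ ς ψ p = fun z => ψ z * symbolKernel ħ ς (mixedGaussian ħ τ ς) z p := rfl

theorem weylIntegrand_crossSymbol (hħ : 0 < ħ) (c : ℂ) (ψ : Phase ι → ℂ)
    (f g : 𝓢(RSpace (ι ⊕ ι), ℂ)) :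
    weylIntegrand ħ (fun p => c * crossSymbol ħ τ ς ψ p) f g = fun p =>
      c * ∫ z, ψ z * symbolKernel ħ ς (mixedGaussian ħ τ ς) z p *
        conj (fourierWigner ħ g (fun t => f (-t)) p) := by
  ext p
  rw [weylIntegrand, symplFourier_fourierWigner hħ f.rapidFourier g.rapidFourier, crossSymbol,
    crossIntegrand_eq, integral_mul_const, mul_assoc]

theorem integrable_prod_symbol (hħ : 0 < ħ) (hτ : 0 < τ) (hς : 0 < ς) {ψ : Phase ι → ℂ} {N : ℕ}
    (hψ : MemLp (fun z => ψ z / (((1 + ‖z‖) ^ N : ℝ) : ℂ)) 2 volume)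
    (f g : 𝓢(RSpace (ι ⊕ ι), ℂ)) :
    Integrable (fun q : Phase ι × Phase (ι ⊕ ι) =>
      ψ q.1 * symbolKernel ħ ς (mixedGaussian ħ τ ς) q.1 q.2 *
        conj (fourierWigner ħ g (fun t => f (-t)) q.2)) (volume.prod volume) := by
  have hfn : RapidFourier fun t => f (-t) := f.rapidFourier.comp_neg
  exact integrable_prod_mul_symbolKernel (continuous_mixedGaussian hħ hτ hς)
    (rapidDecay_mixedGaussian hħ hτ hς) hψ
    (continuous_conj.comp (continuous_fourierWigner ħ g.rapidFourier hfn))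
    ((rapidDecay_fourierWigner hħ g.rapidFourier hfn).of_norm_le fun p => by
      rw [Function.comp_apply, RCLike.norm_conj])

theorem integrable_weylIntegrand_crossSymbol (hħ : 0 < ħ) (hτ : 0 < τ) (hς : 0 < ς) (c : ℂ)
    {ψ : Phase ι → ℂ} {N : ℕ}
    (hψ : MemLp (fun z => ψ z / (((1 + ‖z‖) ^ N : ℝ) : ℂ)) 2 volume)
    (f g : 𝓢(RSpace (ι ⊕ ι), ℂ)) :
    Integrable (weylIntegrand ħ (fun p => c * crossSymbol ħ τ ς ψ p) f g) := by
  rw [weylIntegrand_crossSymbol hħ]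
  exact (integrable_prod_symbol hħ hτ hς hψ f g).integral_prod_right.const_mul c

/-- Fubini, then the rank one identity at each `z`. In `ħ^(3m) = ħ^m ħ^(2m)` the second factor is
consumed by that identity and the first is the constant of the reproducing kernel. -/
theorem weylForm_crossSymbol (hħ : 0 < ħ) (hτ : 0 < τ) (hς : 0 < ς)
    {ψ : Phase ι → ℂ} {N : ℕ}
    (hψ : MemLp (fun z => ψ z / (((1 + ‖z‖) ^ N : ℝ) : ℂ)) 2 volume)
    (f g : 𝓢(RSpace (ι ⊕ ι), ℂ)) :
    weylForm ħ (fun p => ((ħ ^ (3 * Fintype.card ι) : ℝ) : ℂ) * crossSymbol ħ τ ς ψ p) f g =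
      ∫ z, ψ z * phaseIntegral ħ ς f z * (((ħ ^ Fintype.card ι : ℝ) : ℂ) *
        ∫ w, conj (phaseIntegral ħ ς g w) * leftAction ħ z (mixedGaussian ħ τ ς) w) := by
  rw [weylForm, weylIntegrand_crossSymbol hħ, integral_const_mul,
    ← integral_integral_swap (f := fun (z : Phase ι) (p : Phase (ι ⊕ ι)) =>
      ψ z * symbolKernel ħ ς (mixedGaussian ħ τ ς) z p *
        conj (fourierWigner ħ g (fun t => f (-t)) p)) (integrable_prod_symbol hħ hτ hς hψ f g),
    ← integral_const_mul]
  congr 1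
  ext z
  simp only [mul_assoc (ψ z)]
  rw [integral_const_mul]
  have h := integral_symbolKernel_mul_conj_fourierWigner hħ hς (continuous_mixedGaussian hħ hτ hς)
    (rapidDecay_mixedGaussian hħ hτ hς) z f g
  have hp : ((ħ ^ (3 * Fintype.card ι) : ℝ) : ℂ) = ((ħ ^ Fintype.card ι : ℝ) : ℂ) *
      ((ħ ^ (2 * Fintype.card ι) : ℝ) : ℂ) := by
    rw [← ofReal_mul, ← pow_add]
    congr 2
    ring
  rw [hp]
  linear_combination ψ z * ((ħ ^ Fintype.card ι : ℝ) : ℂ) * h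

/-! ### The conjugate form of the symbol -/

/-- This is `⟨φ_ς, ρ(-w)φ_τ⟩ = ⟨ρ(w)φ_ς, φ_τ⟩`, obtained by a translation of the integration
variable. -/
theorem mixedGaussian_neg (w : Phase ι) :
    mixedGaussian ħ τ ς (-w) = conj (mixedGaussian ħ ς τ w) := by
  rw [mixedGaussian, mixedGaussian, fourierWigner, fourierWigner, ← integral_conj,
    ← integral_sub_right_eq_self _ w.1]
  congr 1
  ext t
  have hreal : ∀ (α : ℝ) (s : RSpace ι), conj (squeezedGaussian ħ α s) = squeezedGaussian ħ α s :=
    fun α s => conj_ofReal _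
  simp only [schrodingerRep, map_mul, ← Complex.exp_conj, hreal, Prod.fst_neg, Prod.snd_neg,
    sub_neg_eq_add, sub_add_cancel, conj_ofReal, conj_I, map_neg]
  rw [mul_left_comm, mul_left_comm (squeezedGaussian ħ τ t), mul_comm (squeezedGaussian ħ ς _)]
  congr 2
  simp only [inner_neg_left, inner_neg_right, inner_sub_right, neg_neg, real_inner_comm w.1 w.2]
  push_cast
  ring

theorem leftAction_mixedGaussian (u v : Phase ι) :
    leftAction ħ u (mixedGaussian ħ τ ς) v = conj (leftAction ħ v (mixedGaussian ħ ς τ) u) := by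
  rw [leftAction, leftAction, map_mul, ← neg_sub u v, mixedGaussian_neg, ← Complex.exp_conj]
  congr 2
  simp only [symplForm, map_mul, conj_ofReal, conj_I]
  push_cast
  ring

end

section

variable {ι : Type*} [Fintype ι]
variable {ħ τ ς : ℝ}

/-! ### The operator -/

/-- The operator `V U P_ς M_ψ V⁻¹` on `L²(ℝ²ᵐ)`, with its natural domain. -/
def toeplitzPDO (hħ : 0 < ħ) (hτ : 0 < τ) (hς : 0 < ς) (ψ : Phase ι → ℂ) :
    L2R (ι ⊕ ι) →ₗ.[ℂ] L2R (ι ⊕ ι) where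
  domain := (mulDomain ψ).comap (phaseUnitary hħ hς).toLinearEquiv.toLinearMap
  toFun := (phaseUnitary hħ hς).symm.toLinearEquiv.toLinearMap ∘ₗ (preFSB ι ħ τ).subtype ∘ₗ
    (windowChange hħ hτ hς).toLinearEquiv.toLinearMap ∘ₗ (projMul ħ ς ψ).toFun ∘ₗ
    (phaseUnitary hħ hς).toLinearEquiv.toLinearMap.submoduleComap (mulDomain ψ)

theorem mem_toeplitzPDO_domain (hħ : 0 < ħ) (hτ : 0 < τ) (hς : 0 < ς) (ψ : Phase ι → ℂ)
    (u : L2R (ι ⊕ ι)) :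
    u ∈ (toeplitzPDO hħ hτ hς ψ).domain ↔ phaseUnitary hħ hς u ∈ mulDomain ψ := Iff.rfl

theorem toeplitzPDO_apply (hħ : 0 < ħ) (hτ : 0 < τ) (hς : 0 < ς) (ψ : Phase ι → ℂ)
    (u : (toeplitzPDO hħ hτ hς ψ).domain) :
    toeplitzPDO hħ hτ hς ψ u = (phaseUnitary hħ hς).symm (windowChange hħ hτ hς
      (projMul ħ ς ψ ⟨phaseUnitary hħ hς u, u.2⟩) : L2P ι) := rfl

/-- Everything except multiplication by `ψ` is moved to the other side, where for Schwartz `v` it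
acts by explicit integrals. -/
theorem inner_toeplitzPDO (hħ : 0 < ħ) (hτ : 0 < τ) (hς : 0 < ς) (ψ : Phase ι → ℂ)
    (v : L2R (ι ⊕ ι)) (u : (toeplitzPDO hħ hτ hς ψ).domain) :
    inner ℂ v (toeplitzPDO hħ hτ hς ψ u) =
      inner ℂ (windowChangeAdjoint hħ hτ hς (phaseUnitary hħ hς v))
        (mulOp ψ ⟨phaseUnitary hħ hς u, u.2⟩) := by
  rw [toeplitzPDO_apply, ← (phaseUnitary hħ hς).inner_map_map v,
    LinearIsometryEquiv.apply_symm_apply]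
  exact inner_windowChange_proj hħ hτ hς _ _

/-- The pointwise form of `U P_ς` adjoint applied to `V⁻¹ g`. -/
def adjointIntegral (ħ τ ς : ℝ) (g : RSpace (ι ⊕ ι) → ℂ) (z : Phase ι) : ℂ :=
  ((ħ ^ Fintype.card ι : ℝ) : ℂ) *
    ∫ w, phaseIntegral ħ ς g w * conj (leftAction ħ z (mixedGaussian ħ τ ς) w)

theorem conj_adjointIntegral (g : RSpace (ι ⊕ ι) → ℂ) (z : Phase ι) :
    conj (adjointIntegral ħ τ ς g z) = ((ħ ^ Fintype.card ι : ℝ) : ℂ) *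
      ∫ w, conj (phaseIntegral ħ ς g w) * leftAction ħ z (mixedGaussian ħ τ ς) w := by
  rw [adjointIntegral, map_mul, conj_ofReal, ← integral_conj]
  simp only [map_mul, Complex.conj_conj]

theorem coeFn_windowChangeAdjoint_phaseUnitary (hħ : 0 < ħ) (hτ : 0 < τ) (hς : 0 < ς)
    (g : 𝓢(RSpace (ι ⊕ ι), ℂ)) :
    ⇑(windowChangeAdjoint hħ hτ hς (phaseUnitary hħ hς (g.toLp 2 volume))) =ᵐ[volume]
      adjointIntegral ħ τ ς g := by
  refine (coeFn_windowChangeAdjoint hħ hτ hς _).trans (Filter.Eventually.of_forall fun z => ?_)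
  simp only [adjointIntegral]
  congr 1
  refine integral_congr_ae ((coeFn_phaseUnitary hħ hς g).mono fun w hw => ?_)
  simp only [hw]

/-- The integral is dominated by the correlation of the rapidly decaying functions `V⁻¹g` and
`Φ_τς`. -/
theorem rapidDecay_adjointIntegral (hħ : 0 < ħ) (hτ : 0 < τ) (hς : 0 < ς)
    (g : 𝓢(RSpace (ι ⊕ ι), ℂ)) : RapidDecay (adjointIntegral (ι := ι) ħ τ ς g) := by
  intro N
  obtain ⟨C, hC⟩ := (rapidDecay_phaseIntegral hħ hς g).convolution_le
    (rapidDecay_mixedGaussian hħ hτ hς)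
    (continuous_phaseIntegral hħ hς g).aestronglyMeasurable (μ := volume) N
  refine ⟨ħ ^ Fintype.card ι * C, fun z => ?_⟩
  have h : ‖adjointIntegral ħ τ ς g z‖ ≤ ħ ^ Fintype.card ι *
      ∫ t, ‖phaseIntegral ħ ς g t‖ * ‖mixedGaussian ħ τ ς (t - z)‖ := by
    rw [adjointIntegral, norm_mul, norm_real, Real.norm_of_nonneg (by positivity)]
    gcongr
    refine (norm_integral_le_integral_norm _).trans (le_of_eq ?_)
    simp only [norm_mul, RCLike.norm_conj, norm_leftAction]
  calc _ ≤ ħ ^ Fintype.card ι *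
      (∫ t, ‖phaseIntegral ħ ς g t‖ * ‖mixedGaussian ħ τ ς (t - z)‖) * (1 + ‖z‖) ^ N := by gcongr
    _ = ħ ^ Fintype.card ι *
      ((∫ t, ‖phaseIntegral ħ ς g t‖ * ‖mixedGaussian ħ τ ς (t - z)‖) * (1 + ‖z‖) ^ N) := by ring
    _ ≤ _ := mul_le_mul_of_nonneg_left (hC z) (by positivity)

theorem coeFn_mulOp (ψ : Phase ι → ℂ) (f : mulDomain ψ) :
    ⇑(mulOp ψ f) =ᵐ[volume] fun z => ψ z * (f : L2P ι) z :=
  (mem_mulDomain.1 f.2).coeFn_toLp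

theorem isWeylPDO_toeplitzPDO (hħ : 0 < ħ) (hτ : 0 < τ) (hς : 0 < ς) {ψ : Phase ι → ℂ} {N : ℕ}
    (hψ : MemLp (fun z => ψ z / (((1 + ‖z‖) ^ N : ℝ) : ℂ)) 2 volume) :
    IsWeylPDO ħ (fun p => ((ħ ^ (3 * Fintype.card ι) : ℝ) : ℂ) * crossSymbol ħ τ ς ψ p)
      (toeplitzPDO hħ hτ hς ψ) := by
  refine ⟨integrable_weylIntegrand_crossSymbol hħ hτ hς _ hψ, fun f => ?_, fun g => ?_⟩
  · have hf : f.toLp 2 volume ∈ (toeplitzPDO hħ hτ hς ψ).domain := by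
      rw [mem_toeplitzPDO_domain, mem_mulDomain]
      refine (memLp_congr_ae ?_).2 ((rapidDecay_phaseIntegral hħ hς f).memLp_mul
        (continuous_phaseIntegral hħ hς f).aestronglyMeasurable hψ)
      filter_upwards [coeFn_phaseUnitary hħ hς f] with z hz
      rw [hz]
    refine ⟨hf, fun g => ?_⟩
    rw [inner_toeplitzPDO, weylForm_crossSymbol hħ hτ hς hψ, L2.inner_def]
    refine integral_congr_ae ?_
    filter_upwards [coeFn_windowChangeAdjoint_phaseUnitary hħ hτ hς g,
      coeFn_mulOp ψ ⟨phaseUnitary hħ hς (f.toLp 2 volume), hf⟩, coeFn_phaseUnitary hħ hς f]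
      with z h1 h2 h3
    rw [RCLike.inner_apply, h1, h2, h3, conj_adjointIntegral]
  · have hae := coeFn_windowChangeAdjoint_phaseUnitary hħ hτ hς g
    have hm : AEStronglyMeasurable (adjointIntegral (ι := ι) ħ τ ς g) volume :=
      (Lp.aestronglyMeasurable _).congr hae
    -- For `G = J_ς J_τ* V⁻¹g` the adjoint of `A` sends `g` to `V (conj ψ · G)`; the product is in
    -- `L²` because `G` decays rapidly.
    have hmem : MemLp (fun z => conj (ψ z * conj (adjointIntegral ħ τ ς g z))) 2 volume :=
      (RapidDecay.memLp_mul ((rapidDecay_adjointIntegral hħ hτ hς g).of_norm_le fun z => by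
        rw [RCLike.norm_conj]) (continuous_conj.comp_aestronglyMeasurable hm) hψ).star
    refine ⟨(phaseUnitary hħ hς).symm (hmem.toLp _), fun u => ?_⟩
    rw [inner_toeplitzPDO, ← (phaseUnitary hħ hς).inner_map_map _ (u : L2R (ι ⊕ ι)),
      LinearIsometryEquiv.apply_symm_apply, L2.inner_def, L2.inner_def]
    refine integral_congr_ae ?_
    filter_upwards [hae, coeFn_mulOp ψ ⟨phaseUnitary hħ hς u, u.2⟩, hmem.coeFn_toLp]
      with z h1 h2 h3
    rw [RCLike.inner_apply, RCLike.inner_apply, h1, h2, h3, Complex.conj_conj]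
    ring

end

end

/-! ### The main theorem -/

theorem mainTheorem5 (n : ℕ) (ħ τ ς : ℝ) (hħ : 0 < ħ) (hτ : 0 < τ) (hς : 0 < ς) :
    ∃ (V : L2P (Fin n) ≃ₗᵢ[ℂ] L2R (Fin n ⊕ Fin n))
      (U : preFSB (Fin n) ħ ς ≃ₗᵢ[ℂ] preFSB (Fin n) ħ τ),
      -- `U` sends the `φ_ς`-transform of `h` to the `φ_τ`-transform of `h`
      (∀ (h : L2R (Fin n)) (F : preFSB (Fin n) ħ ς),
        ⇑(F : L2P (Fin n)) =ᵐ[volume] fourierWigner ħ h (squeezedGaussian ħ ς) →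
        ⇑(U F : L2P (Fin n)) =ᵐ[volume] fourierWigner ħ h (squeezedGaussian ħ τ)) ∧
      ∀ ψ : Phase (Fin n) → ℂ,
        (∃ N : ℕ, MemLp (fun z => ψ z / (((1 + ‖z‖) ^ N : ℝ) : ℂ)) 2 volume) →
        -- the integral for the symbol converges absolutely, and its second form
        (∀ p : Phase (Fin n ⊕ Fin n), Integrable (crossIntegrand ħ τ ς ψ p) ∧
          crossSymbol ħ τ ς ψ p =
            ∫ z, ψ z * conj (leftAction ħ (ς • part₂ p.2, ς⁻¹ • part₂ p.1)
              (mixedGaussian ħ ς τ) ((2 : ℝ) • z - (part₁ p.1, part₁ p.2)))) ∧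
        -- the pseudo-differential operator and the unitary equivalence
        ∃ A : L2R (Fin n ⊕ Fin n) →ₗ.[ℂ] L2R (Fin n ⊕ Fin n),
          IsWeylPDO ħ (fun p => ((ħ ^ (3 * n) : ℝ) : ℂ) * crossSymbol ħ τ ς ψ p) A ∧
          (∀ f : L2P (Fin n), V f ∈ A.domain ↔ f ∈ (projMul ħ ς ψ).domain) ∧
          (∀ (f : (projMul ħ ς ψ).domain) (hf : V (f : L2P (Fin n)) ∈ A.domain),
            A ⟨V (f : L2P (Fin n)), hf⟩ = V (U (projMul ħ ς ψ f) : L2P (Fin n))) ∧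
          (∀ f : preFSB (Fin n) ħ τ,
            V (f : L2P (Fin n)) ∈ A.domain ↔ f ∈ (crossToeplitz ħ τ ς ψ).domain) ∧
          (∀ (f : (crossToeplitz ħ τ ς ψ).domain)
            (hf : V ((f : preFSB (Fin n) ħ τ) : L2P (Fin n)) ∈ A.domain),
            A ⟨V ((f : preFSB (Fin n) ħ τ) : L2P (Fin n)), hf⟩ =
              V (U (crossToeplitz ħ τ ς ψ f) : L2P (Fin n))) := by
  -- `V` is the inverse of the integral transform. The domain equivalences and intertwining
  -- relations then reduce to cancelling `V⁻¹ V`, since `crossToeplitz` is definitionally the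
  -- restriction of `projMul` to `F_τ`.
  refine ⟨(phaseUnitary hħ hς).symm, windowChange hħ hτ hς,
    windowChange_fourierWigner hħ hτ hς, fun ψ ⟨N, hψ⟩ => ⟨fun p => ⟨?_, ?_⟩,
    toeplitzPDO hħ hτ hς ψ, ?_, fun f => ?_, fun f hf => ?_, fun f => ?_, fun f hf => ?_⟩⟩
  · exact integrable_mul_symbolKernel (continuous_mixedGaussian hħ hτ hς)
      (rapidDecay_mixedGaussian hħ hτ hς) hψ p
  · exact integral_congr_ae (Filter.Eventually.of_forall fun z =>
      congrArg (ψ z * ·) (leftAction_mixedGaussian _ _))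
  · have h := isWeylPDO_toeplitzPDO hħ hτ hς hψ
    rwa [Fintype.card_fin] at h
  · rw [mem_toeplitzPDO_domain, LinearIsometryEquiv.apply_symm_apply]
    rfl
  · rw [toeplitzPDO_apply]
    simp only [LinearIsometryEquiv.apply_symm_apply]
  · rw [mem_toeplitzPDO_domain, LinearIsometryEquiv.apply_symm_apply]
    rfl
  · rw [toeplitzPDO_apply]
    simp only [LinearIsometryEquiv.apply_symm_apply]
    rfl
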